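/- Let $m\ge 2$. A *$C^1$-parametrized surface* in $\mathbb{R}^m$ is a $C^1$ map $x:U\to\mathbb{R}^m$, where $U\subset\mathbb{R}^{m-1}$ is a Jordan measurable bounded closed domain (a compact set that is the closure of its interior $U^\circ$ and whose boundary $\partial U$ is a null set), such that on $U^\circ$ the map $x$ is injective and $\operatorname{rank}(\partial x^i/\partial u^j)=m-1$. Put $$N(u)=\Big(\tfrac{\partial(x^2,\dots,x^m)}{\partial(u^1,\dots,u^{m-1})},\dots,(-1)^{m+1}\tfrac{\partial(x^1,\dots,x^{m-1})}{\partial(u^1,\dots,u^{m-1})}\Big),$$ whose $i$-th component is $(-1)^{i+1}$ times the determinant of the Jacobian matrix of $x$ with the $i$-th row deleted, and, for $S=x(U)$ and $f:S\to\mathbb{R}$, $\int_S f\,d\sigma=\int_U f(x(u))\,|N(u)|\,du$. A *piecewise $C^1$-hypersurface* is a set $\Sigma=\bigcup_{i=1}^{\ell}S_i$ with $S_i=x_i(U_i)$ for $C^1$-parametrized surfaces $x_i:U_i\to\mathbb{R}^m$ such that $x_i(U_i^\circ)\cap x_j(U_j^\circ)=\emptyset$ for $i\ne j$, and $\int_\Sigma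 f\,d\sigma=\sum_{i=1}^{\ell}\int_{S_i}f\,d\sigma$. **Theorem (Divergence Theorem).** Let $D\subset\mathbb{R}^m$ be a bounded open set whose boundary $\partial D$ is a piecewise $C^1$-hypersurface $\bigcup_{i=1}^\ell x_i(U_i)$, and let $F:\bar D\to\mathbb{R}^m$ be a $C^1$ vector field. Let $n$ be the unit outer normal vector field on $\partial D$: at every point $y=x_i(u)$ with $u\in U_i^\circ$ and $y\notin\bigcup_j x_j(\partial U_j)$, the vector $n(y)$ has length one, is orthogonal to the image of $x_i'(u)$, and satisfies $y+t\,n(y)\notin\bar D$ and $y-t\,n(y)\in D$ for all sufficiently small $t>0$. Then $\operatorname{div}F$ is integrable on $D$, the surface integral below exists, and $$\int_D\operatorname{div}F\,dx=\int_{\partial D}F\cdot n\,d\sigma .$$ Here a map is $C^1$ on a compact set $K$ if, at each point of $K$, it is differentiable relative to $K$, with derivatives that can be chosen continuously near each point of $K$. -/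

import Mathlib

open Set MeasureTheory Topology

noncomputable section

/-- A `C¹`-parametrized surface of codimension one in `ℝⁿ⁺¹`: a `C¹` map `x : U → ℝⁿ⁺¹` on a
Jordan measurable bounded closed domain `U ⊆ ℝⁿ` (a compact set which is the closure of its
interior and whose boundary is Lebesgue null), injective and of rank `n` in the interior of `U`. -/
structure ParametrizedSurface (n : ℕ) where
  /-- the parameter domain -/
  U : Set (EuclideanSpace ℝ (Fin n))
  /-- the parametrization; only its values on `U` matter -/
  x : EuclideanSpace ℝ (Fin n) → EuclideanSpace ℝ (Fin (n + 1))
  isCompact_U : IsCompact U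
  closure_interior_U : closure (interior U) = U
  volume_frontier_U : volume (frontier U) = 0
  contDiffOn_x : ContDiffOn ℝ 1 x U
  injOn_x : InjOn x (interior U)
  rank_eq : ∀ u ∈ interior U,
    (Matrix.of fun (i : Fin (n + 1)) (j : Fin n) =>
      fderivWithin ℝ x U u (EuclideanSpace.single j 1) i).rank = n

namespace ParametrizedSurface

variable {n : ℕ} (S : ParametrizedSurface n)

/-- The Jacobian matrix `(∂xⁱ/∂uʲ)` at `u`. -/
def jacobian (u : EuclideanSpace ℝ (Fin n)) : Matrix (Fin (n + 1)) (Fin n) ℝ :=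
  Matrix.of fun i j => fderivWithin ℝ S.x S.U u (EuclideanSpace.single j 1) i

/-- The normal vector `N(u)`: its `i`-th component (counted from `0`) is `(-1)ⁱ` times the
determinant of the Jacobian matrix with the `i`-th row deleted. -/
def normalVector (u : EuclideanSpace ℝ (Fin n)) : EuclideanSpace ℝ (Fin (n + 1)) :=
  WithLp.toLp 2 fun i => (-1 : ℝ) ^ (i : ℕ) * ((S.jacobian u).submatrix i.succAbove id).det

/-- The hypersurface as a subset of `ℝⁿ⁺¹`. -/
def carrier : Set (EuclideanSpace ℝ (Fin (n + 1))) := S.x '' S.U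

/-- The image of the boundary of the parameter domain. -/
def edge : Set (EuclideanSpace ℝ (Fin (n + 1))) := S.x '' frontier S.U

/-- Existence of the surface integral of `f`. -/
def SurfaceIntegrable (f : EuclideanSpace ℝ (Fin (n + 1)) → ℝ) : Prop :=
  IntegrableOn (fun u => f (S.x u) * ‖S.normalVector u‖) S.U

/-- The surface integral `∫_U f(x(u)) |N(u)| du`. -/
def surfaceIntegral (f : EuclideanSpace ℝ (Fin (n + 1)) → ℝ) : ℝ :=
  ∫ u in S.U, f (S.x u) * ‖S.normalVector u‖

/-- `ν` is a unit outer normal of `D` at the point `x(u)` of the surface: it has length one, is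
orthogonal to all tangent vectors at `x(u)`, points out of `D`, and `-ν` points into `D`. -/
def IsUnitOuterNormalAt (D : Set (EuclideanSpace ℝ (Fin (n + 1))))
    (u : EuclideanSpace ℝ (Fin n)) (ν : EuclideanSpace ℝ (Fin (n + 1))) : Prop :=
  ‖ν‖ = 1 ∧ (∀ v, inner ℝ ν (fderivWithin ℝ S.x S.U u v) = 0) ∧
    ∀ᶠ t in 𝓝[>] (0 : ℝ), S.x u + t • ν ∉ closure D ∧ S.x u - t • ν ∈ D

end ParametrizedSurface

/-- A piecewise `C¹`-hypersurface: finitely many parametrized surfaces such that the images of the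
interiors of the parameter domains are pairwise disjoint. -/
structure PiecewiseHypersurface (n : ℕ) where
  /-- the number of pieces -/
  len : ℕ
  /-- the pieces -/
  piece : Fin len → ParametrizedSurface n
  disjoint_interiors : ∀ i j, i ≠ j →
    Disjoint ((piece i).x '' interior (piece i).U) ((piece j).x '' interior (piece j).U)

namespace PiecewiseHypersurface

variable {n : ℕ} (S : PiecewiseHypersurface n)

/-- The piecewise `C¹`-hypersurface as a subset of `ℝⁿ⁺¹`. -/
def carrier : Set (EuclideanSpace ℝ (Fin (n + 1))) := ⋃ i, (S.piece i).carrier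

/-- The union of the edges of the pieces. -/
def edges : Set (EuclideanSpace ℝ (Fin (n + 1))) := ⋃ i, (S.piece i).edge

/-- Existence of the surface integral of `f`. -/
def SurfaceIntegrable (f : EuclideanSpace ℝ (Fin (n + 1)) → ℝ) : Prop :=
  ∀ i, (S.piece i).SurfaceIntegrable f

/-- The surface integral, the sum of the integrals over the pieces. -/
def surfaceIntegral (f : EuclideanSpace ℝ (Fin (n + 1)) → ℝ) : ℝ :=
  ∑ i, (S.piece i).surfaceIntegral f

/-- `ν` is the unit outer normal vector field of `D` on its boundary `S`: it is a unit outer normal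
at all points of `S` off the edges. -/
def IsUnitOuterNormalField (D : Set (EuclideanSpace ℝ (Fin (n + 1))))
    (ν : EuclideanSpace ℝ (Fin (n + 1)) → EuclideanSpace ℝ (Fin (n + 1))) : Prop :=
  ∀ i, ∀ u ∈ interior (S.piece i).U, (S.piece i).x u ∉ S.edges →
    (S.piece i).IsUnitOuterNormalAt D u (ν ((S.piece i).x u))

end PiecewiseHypersurface

/-- The divergence `∑ᵢ ∂Fⁱ/∂xⁱ` of a vector field on `ℝᵐ`. -/
def divergence {m : ℕ} (F : EuclideanSpace ℝ (Fin m) → EuclideanSpace ℝ (Fin m))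
    (y : EuclideanSpace ℝ (Fin m)) : ℝ :=
  ∑ i, fderiv ℝ F y (EuclideanSpace.single i 1) i

end

/-!
# The divergence theorem for piecewise `C¹` boundaries

The theorem is proved one coordinate direction at a time, by slicing `D` with the lines parallel to
the `i`-th axis; no smoothing, partition of unity or graph representation of the boundary is needed.

* By Fubini, `∫_D ∂ᵢf` is the integral over `y ∈ ℝⁿ` of the integrals of `∂ᵢf` over the slices
  `D ∩ L_y` of the lines `L_y` parallel to the `i`-th axis.
* For almost every `y` the line `L_y` is transversal (`ae_isTransversalLine`): it misses the edges,
  whose projections are images of null sets under differentiable maps `ℝⁿ → ℝⁿ`, and it meets the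
  pieces only where `Nᵢ ≠ 0`, since `Nᵢ` is up to sign the Jacobian of the projected
  parametrization, so that Sard's theorem in equal dimensions applies.
* At a transversal point of the boundary the line passes from `D` to the exterior or back, according
  to the sign of `νᵢ` (`IsUnitOuterNormalField.crossing`). Indeed the boundary is tangent to the
  hyperplane orthogonal to `ν` to first order, so the segment from `p + tν` to `p ± teᵢ` does not
  meet it for small `t > 0`. In particular the crossings are isolated, hence finite in number, and
  the fundamental theorem of calculus (`setIntegral_deriv_eq_sum_of_finite_frontier`) turns the
  integral over the slice into the sum of `sign(νᵢ) f` over the crossings.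
* The area formula with multiplicity (`integrable_tsum_fibre_and_integral_eq`), applied to the
  projected parametrizations, identifies the integral of these sums over `y` with
  `∑_j ∫_{U_j} sign(νᵢ) f |Nᵢ|`.

Finally `ν` is parallel to `N`, so `νᵢ|N| = sign(νᵢ)|Nᵢ|`
(`ParametrizedSurface.apply_mul_norm_normalVector`), and summing over `i` with `f = Fⁱ` gives the
surface integral of `F · ν`. As `ν` is arbitrary at the points of edges, the parameters in `U_j°`
which are mapped into some edge have to be negligible: almost everywhere on this set `N = 0`,
because the projections of the edges are null sets. Measurability of the integrand comes from replacing
`sign(νᵢ)` by the Borel function `exitSign`.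
-/

open Filter

/-! ### The area formula with multiplicity -/

section AreaFormula

variable {E : Type*} [NormedAddCommGroup E] [NormedSpace ℝ E] [FiniteDimensional ℝ E]
  [MeasurableSpace E] [BorelSpace E]

/-- On each piece the map approximates an invertible linear map so closely that it is injective. -/
theorem exists_measurable_partition_injOn_of_det_ne_zero {G : Set E} {φ : E → E}
    {φ' : E → E →L[ℝ] E} (hφ : ∀ u ∈ G, HasFDerivWithinAt φ (φ' u) G u)
    (hdet : ∀ u ∈ G, (φ' u).det ≠ 0) :
    ∃ t : ℕ → Set E, Pairwise (Function.onFun Disjoint t) ∧ (∀ k, MeasurableSet (t k)) ∧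
      G ⊆ ⋃ k, t k ∧ ∀ k, InjOn φ (G ∩ t k) := by
  classical
  -- a linear map within `‖A⁻¹‖⁻¹ / 2` of an invertible `A` is injective
  have hr : ∀ A : E →L[ℝ] E, ∃ r : NNReal, r ≠ 0 ∧ (A.det ≠ 0 → ∀ s : Set E,
      ApproximatesLinearOn φ A s r → InjOn φ s) := by
    intro A
    by_cases hA : A.det ≠ 0
    · rcases subsingleton_or_nontrivial E with hE | hE
      · exact ⟨1, one_ne_zero, fun _ s _ x _ y _ _ => Subsingleton.elim x y⟩
      · set B := A.toContinuousLinearEquivOfDetNeZero hA with hB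
        have hpos : 0 < ‖(B.symm : E →L[ℝ] E)‖₊⁻¹ := inv_pos.mpr B.nnnorm_symm_pos
        refine ⟨‖(B.symm : E →L[ℝ] E)‖₊⁻¹ / 2, (half_pos hpos).ne', fun _ s hs => ?_⟩
        exact ApproximatesLinearOn.injOn (f' := B) hs (Or.inr (half_lt_self hpos))
    · exact ⟨1, one_ne_zero, fun h => absurd h hA⟩
  choose r hr0 hr using hr
  obtain ⟨t, A, hdisj, hmeas, hcov, happ, hA⟩ :=
    exists_partition_approximatesLinearOn_of_hasFDerivWithinAt φ G φ' hφ r hr0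
  refine ⟨t, hdisj, hmeas, hcov, fun k => ?_⟩
  rcases G.eq_empty_or_nonempty with rfl | hne
  · simp
  · obtain ⟨y, hy, hAy⟩ := hA hne k
    exact hr (A k) (hAy ▸ hdet y hy) _ (happ k)

theorem measure_eq_zero_of_image_null_of_det_ne_zero (μ : Measure E) [μ.IsAddHaarMeasure]
    {G : Set E} {φ : E → E} {φ' : E → E →L[ℝ] E} (hG : MeasurableSet G)
    (hφ : ∀ u ∈ G, HasFDerivWithinAt φ (φ' u) G u) (hdet : ∀ u ∈ G, (φ' u).det ≠ 0)
    (hnull : μ (φ '' G) = 0) : μ G = 0 := by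
  obtain ⟨t, -, htm, hcov, hinj⟩ := exists_measurable_partition_injOn_of_det_ne_zero hφ hdet
  have hGt : G = ⋃ k, G ∩ t k := by rw [← inter_iUnion, inter_eq_left.mpr hcov]
  rw [hGt]
  refine measure_iUnion_null fun k => ?_
  have hm := hG.inter (htm k)
  have h := lintegral_abs_det_fderiv_eq_addHaar_image μ hm
    (fun u hu => (hφ u hu.1).mono inter_subset_left) (hinj k)
  rw [measure_mono_null (image_mono inter_subset_left) hnull, setLIntegral_eq_zero_iff' hm
    (aemeasurable_ofReal_abs_det_fderivWithin μ hm
      fun u hu => (hφ u hu.1).mono inter_subset_left)] at h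
  refine measure_mono_null (fun u hu => ?_) h
  simpa [hu.1, hu.2] using hdet u hu.1

/-- The area formula with multiplicity: a map with invertible derivatives is injective on the
pieces of a countable partition, and the change of variables formulas on the pieces add up. -/
theorem integrable_tsum_fibre_and_integral_eq (μ : Measure E) [μ.IsAddHaarMeasure]
    {G : Set E} {φ : E → E} {φ' : E → E →L[ℝ] E} (hG : MeasurableSet G)
    (hφ : ∀ u ∈ G, HasFDerivWithinAt φ (φ' u) G u) (hdet : ∀ u ∈ G, (φ' u).det ≠ 0)
    {g : E → ℝ} (hg : IntegrableOn (fun u => |(φ' u).det| * g u) G μ) :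
    Integrable (fun y => ∑' u : ↥(G ∩ φ ⁻¹' {y}), g u) μ ∧
      ∫ y, ∑' u : ↥(G ∩ φ ⁻¹' {y}), g u ∂μ = ∫ u in G, |(φ' u).det| * g u ∂μ := by
  classical
  obtain ⟨t, hdisj, htm, hcov, hinj⟩ := exists_measurable_partition_injOn_of_det_ne_zero hφ hdet
  have hGt : G = ⋃ k, G ∩ t k := by rw [← inter_iUnion, inter_eq_left.mpr hcov]
  have hm : ∀ k, MeasurableSet (G ∩ t k) := fun k => hG.inter (htm k)
  have hφk : ∀ k, ∀ u ∈ G ∩ t k, HasFDerivWithinAt φ (φ' u) (G ∩ t k) u :=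
    fun k u hu => (hφ u hu.1).mono inter_subset_left
  have him : ∀ k, MeasurableSet (φ '' (G ∩ t k)) := fun k =>
    measurable_image_of_fderivWithin (hm k) (hφk k) (hinj k)
  let ψ : ℕ → E → E := fun k => Function.invFunOn φ (G ∩ t k)
  have hψ : ∀ k, ∀ u ∈ G ∩ t k, ψ k (φ u) = u := fun k u hu => 
    (hinj k).leftInvOn_invFunOn hu
  let f : ℕ → E → ℝ := fun k => (φ '' (G ∩ t k)).indicator (fun y => g (ψ k y))
  have hfint : ∀ k, Integrable (f k) μ := by
    intro k
    rw [integrable_indicator_iff (him k),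
      integrableOn_image_iff_integrableOn_abs_det_fderiv_smul μ (hm k) (hφk k) (hinj k)]
    refine (hg.mono_set inter_subset_left).congr_fun (fun u hu => ?_) (hm k)
    simp [hψ k u hu]
  have hfeq : ∀ k, ∫ y, f k y ∂μ = ∫ u in G ∩ t k, |(φ' u).det| * g u ∂μ := by
    intro k
    rw [integral_indicator (him k),
      integral_image_eq_integral_abs_det_fderiv_smul μ (hm k) (hφk k) (hinj k)]
    exact setIntegral_congr_fun (hm k) fun u hu => by simp [hψ k u hu]
  have hfnorm : ∀ k, ∫ y, ‖f k y‖ ∂μ = ∫ u in G ∩ t k, ‖|(φ' u).det| * g u‖ ∂μ := by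
    intro k
    simp only [f, norm_indicator_eq_indicator_norm]
    rw [integral_indicator (him k),
      integral_image_eq_integral_abs_det_fderiv_smul μ (hm k) (hφk k) (hinj k)]
    exact setIntegral_congr_fun (hm k) fun u hu => by simp [hψ k u hu]
  have hdisjG : Pairwise (Function.onFun Disjoint fun k => G ∩ t k) := fun i j hij =>
    (hdisj hij).mono inter_subset_right inter_subset_right
  have hsum : Summable fun k => ∫ y, ‖f k y‖ ∂μ := by
    simp only [hfnorm]
    have hgn := hg.norm
    rw [hGt] at hgn
    exact (hasSum_integral_iUnion hm hdisjG hgn).summable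
  have hfib : ∀ y, ∑' u : ↥(G ∩ φ ⁻¹' {y}), g u = ∑' k, f k y := by
    intro y
    -- a piece meets a fibre in at most one point, so the fibre is indexed by its pieces
    have hκ : ∀ u : ↥(G ∩ φ ⁻¹' {y}), ∃ k, (u : E) ∈ t k := fun u => mem_iUnion.mp (hcov u.2.1)
    choose κ hκ using hκ
    have hφy : ∀ u : ↥(G ∩ φ ⁻¹' {y}), φ u = y := fun u => u.2.2
    have hκinj : Function.Injective κ := fun u v huv =>
      Subtype.ext (hinj (κ u) ⟨u.2.1, hκ u⟩ ⟨v.2.1, huv ▸ hκ v⟩ ((hφy u).trans (hφy v).symm))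
    have hsupp : Function.support (fun k => f k y) ⊆ range κ := by
      intro k hk
      obtain ⟨u, hu, huy⟩ := mem_of_indicator_ne_zero hk
      refine ⟨⟨u, hu.1, huy⟩, ?_⟩
      by_contra hne
      exact disjoint_left.mp (hdisj hne) (hκ ⟨u, hu.1, huy⟩) hu.2
    rw [← hκinj.tsum_eq hsupp]
    refine tsum_congr fun u => ?_
    have hu : (u : E) ∈ G ∩ t (κ u) := ⟨u.2.1, hκ u⟩
    have : y ∈ φ '' (G ∩ t (κ u)) := ⟨u, hu, hφy u⟩
    simp only [f, indicator_of_mem this]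
    exact congrArg g ((hψ _ _ hu).symm.trans (congrArg _ (hφy u)))
  simp only [hfib]
  refine ⟨?_, ?_⟩
  · refine ⟨(AEMeasurable.tsum fun k => (hfint k).1.aemeasurable).aestronglyMeasurable, ?_⟩
    have hle : ∀ y, ‖∑' k, f k y‖ₑ ≤ ∑' k, ‖f k y‖ₑ := fun y => enorm_tsum_le_tsum_enorm
    refine (lintegral_mono hle).trans_lt ?_
    rw [lintegral_tsum fun k => (hfint k).1.enorm]
    simp only [← ofReal_integral_norm_eq_lintegral_enorm (hfint _)]
    rw [← ENNReal.ofReal_tsum_of_nonneg (fun k => integral_nonneg fun y => norm_nonneg _) hsum]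
    exact ENNReal.ofReal_lt_top
  · rw [← (hasSum_integral_of_summable_integral_norm hfint hsum).tsum_eq]
    simp only [hfeq]
    conv_rhs => rw [hGt]
    rw [hGt] at hg
    exact (hasSum_integral_iUnion hm hdisjG hg).tsum_eq

end AreaFormula

/-! ### The fundamental theorem of calculus on an open set with finite frontier -/

section Line

/-- The fundamental theorem of calculus on a bounded open subset of the line with finite frontier.
The hypothesis `hσ` says that each `a ∈ A` is a right endpoint (`σ a = 1`) or a left endpoint
(`σ a = -1`) of `O`; a common endpoint of two components is excluded. -/
theorem setIntegral_deriv_eq_sum_of_finite_frontier {O : Set ℝ} (hO : IsOpen O)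
    (hb : Bornology.IsBounded O) {A : Finset ℝ} (hA : frontier O ⊆ A) {f f' σ : ℝ → ℝ}
    (hf : ContinuousOn f (closure O)) (hd : ∀ t ∈ O, HasDerivAt f (f' t) t)
    (hi : IntegrableOn f' O)
    (hσ : ∀ a ∈ A, (σ a = 1 ∧ (∀ᶠ t in 𝓝[<] a, t ∈ O) ∧ ∀ᶠ t in 𝓝[>] a, t ∉ O) ∨
      (σ a = -1 ∧ (∀ᶠ t in 𝓝[<] a, t ∉ O) ∧ ∀ᶠ t in 𝓝[>] a, t ∈ O)) :
    ∫ t in O, f' t = ∑ a ∈ A, σ a * f a := by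
  classical
  set S : ℝ → ℝ := fun t => ∑ a ∈ A, if a < t then σ a * f a else 0 with hS
  -- `S` compensates the jumps of the extension of `f` by zero, so the sum `K` is continuous; at an
  -- endpoint `K` is given the limit from the left
  set K : ℝ → ℝ := fun t => S t + if t ∈ O ∨ (t ∈ A ∧ σ t = 1) then f t else 0 with hK
  have hside : ∀ t, ∀ᶠ s in 𝓝 t, ∀ a ∈ A, a ≠ t → (a < s ↔ a < t) := by
    intro t
    rw [Finset.eventually_all]
    intro a _
    by_cases hat : a = t
    · simp [hat]
    rcases lt_or_gt_of_ne hat with h | h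
    · filter_upwards [lt_mem_nhds h] with s hs _
      exact iff_of_true hs h
    · filter_upwards [gt_mem_nhds h] with s hs _
      exact iff_of_false (not_lt.mpr hs.le) (not_lt.mpr h.le)
  have hmem : ∀ t, ∀ᶠ s in 𝓝[≠] t, s ∉ A := by
    intro t
    have : (((A : Set ℝ) \ {t})ᶜ) ∈ 𝓝 t :=
      (A.finite_toSet.sdiff.isClosed.isOpen_compl).mem_nhds (by simp)
    filter_upwards [mem_nhdsWithin_of_mem_nhds this, self_mem_nhdsWithin] with s hs hst hsA
    exact hs ⟨hsA, hst⟩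
  have hnot : ∀ a ∈ A, a ∉ O := by
    intro a ha haO
    rcases hσ a ha with ⟨-, -, h⟩ | ⟨-, h, -⟩
    · obtain ⟨t, h1, h2⟩ := (h.and (mem_nhdsWithin_of_mem_nhds (hO.mem_nhds haO))).exists
      exact h1 h2
    · obtain ⟨t, h1, h2⟩ := (h.and (mem_nhdsWithin_of_mem_nhds (hO.mem_nhds haO))).exists
      exact h1 h2
  have hderiv : ∀ t, t ∉ A → HasDerivAt K (O.indicator f' t) t := by
    intro t htA
    have hSt : ∀ᶠ s in 𝓝 t, S s = S t := by
      filter_upwards [hside t] with s hs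
      exact Finset.sum_congr rfl fun a ha => by
        simp only [hs a ha (fun h => htA (h ▸ ha))]
    have hAt : ∀ᶠ s in 𝓝 t, s ∉ A := 
      (A.finite_toSet.isClosed.isOpen_compl).mem_nhds (by simpa using htA)
    by_cases htO : t ∈ O
    · rw [indicator_of_mem htO]
      refine ((hd t htO).const_add (S t)).congr_of_eventuallyEq ?_
      filter_upwards [hSt, hO.mem_nhds htO] with s h1 h2
      simp [hK, h1, h2]
    · rw [indicator_of_notMem htO]
      have htc : t ∉ closure O := fun h => htA (hA ⟨h, by rwa [hO.interior_eq]⟩)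
      refine (hasDerivAt_const t (S t)).congr_of_eventuallyEq ?_
      filter_upwards [hSt, hAt, isClosed_closure.isOpen_compl.mem_nhds htc] with s h1 h2 h3
      have : s ∉ O := fun h => h3 (subset_closure h)
      simp [hK, h1, h2, this]
  have hcont : ∀ t, ContinuousAt K t := by
    intro a
    by_cases ha : a ∈ A
    swap
    · exact (hderiv a ha).continuousAt
    have hneA := hmem a
    have hleft : ∀ᶠ s in 𝓝[<] a, S s = S a := by
      filter_upwards [mem_nhdsWithin_of_mem_nhds (hside a), self_mem_nhdsWithin] with s hs hsa
      refine Finset.sum_congr rfl fun b hb => ?_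
      by_cases hba : b = a
      · subst hba
        simp [not_lt.mpr (le_of_lt (show s < b from hsa))]
      · simp only [hs b hb hba]
    have hright : ∀ᶠ s in 𝓝[>] a, S s = S a + σ a * f a := by
      filter_upwards [mem_nhdsWithin_of_mem_nhds (hside a), self_mem_nhdsWithin] with s hs hsa
      rw [← sub_eq_iff_eq_add', hS, ← Finset.sum_sub_distrib, Finset.sum_eq_single a]
      · simp [show a < s from hsa]
      · intro b hb hba
        simp only [hs b hb hba, sub_self]
      · exact fun h => absurd ha h
    have hltne : 𝓝[<] a ≤ 𝓝[≠] a := nhdsWithin_mono _ fun s (hs : s < a) => hs.ne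
    have hgtne : 𝓝[>] a ≤ 𝓝[≠] a := nhdsWithin_mono _ fun s (hs : a < s) => hs.ne'
    rw [continuousAt_iff_continuous_left'_right']
    have hlim : ∀ l : Filter ℝ, l ≤ 𝓝 a → (∀ᶠ s in l, s ∈ O) → l.NeBot →
        Tendsto f l (𝓝 (f a)) := by
      intro l hl hlO _
      have hac : a ∈ closure O :=
        mem_closure_iff_frequently.mpr (hlO.frequently.filter_mono hl)
      exact (hf a hac).mono_left (le_inf hl (le_principal_iff.mpr
        (hlO.mono fun s hs => subset_closure hs)))
    rcases hσ a ha with ⟨h1, h2, h3⟩ | ⟨h1, h2, h3⟩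
    · have hKa : K a = S a + f a := by simp [hK, ha, h1]
      constructor
      · rw [ContinuousWithinAt, hKa]
        refine ((hlim _ nhdsWithin_le_nhds h2 inferInstance).const_add (S a)).congr' ?_
        filter_upwards [hleft, h2] with s hs hsO
        simp [hK, hs, hsO]
      · rw [ContinuousWithinAt, hKa]
        refine tendsto_const_nhds.congr' ?_
        filter_upwards [hright, h3, hgtne hneA] with s hs hsO hsA
        simp [hK, hs, hsO, hsA, h1]
    · have hKa : K a = S a := by simp [hK, h1, hnot a ha]; norm_num
      constructor
      · rw [ContinuousWithinAt, hKa]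
        refine tendsto_const_nhds.congr' ?_
        filter_upwards [hleft, h2, hltne hneA] with s hs hsO hsA
        simp [hK, hs, hsO, hsA]
      · rw [ContinuousWithinAt, hKa]
        have := ((hlim _ nhdsWithin_le_nhds h3 inferInstance).const_add (S a + σ a * f a))
        rw [h1, show S a + -1 * f a + f a = S a by ring] at this
        refine this.congr' ?_
        filter_upwards [hright, h3] with s hs hsO
        simp [hK, hs, hsO, h1]
  obtain ⟨R, hR⟩ := (hb.union A.finite_toSet.isBounded).subset_ball 0
  have hOR : ∀ t ∈ O, |t| < R := fun t ht => by simpa using hR (Or.inl ht)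
  have hAR : ∀ t ∈ A, |t| < R := fun t ht => by simpa using hR (Or.inr ht)
  set R' := max R 0 with hR'
  have hRR : R ≤ R' := le_max_left _ _
  have hR0 : -R' ≤ R' := by linarith [le_max_right R 0]
  have hint : Integrable (O.indicator f') := (integrable_indicator_iff hO.measurableSet).mpr hi
  have key := integral_eq_of_hasDerivAt_off_countable_of_le K (O.indicator f') hR0
    A.countable_toSet (fun t _ => (hcont t).continuousWithinAt) (fun t ht => hderiv t ht.2)
    hint.intervalIntegrable
  have e1 : K R' = ∑ a ∈ A, σ a * f a := by
    have h1 : R' ∉ O := fun h => absurd (hOR _ h) (not_lt.mpr (hRR.trans (le_abs_self _)))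
    have h2 : R' ∉ A := fun h => absurd (hAR _ h) (not_lt.mpr (hRR.trans (le_abs_self _)))
    simp only [hK, h1, h2, false_or, false_and, if_false, add_zero, hS]
    refine Finset.sum_congr rfl fun a ha => ?_
    rw [if_pos (((le_abs_self a).trans_lt (hAR a ha)).trans_le hRR)]
  have e2 : K (-R') = 0 := by
    have h1 : -R' ∉ O := fun h => absurd (hOR _ h)
      (not_lt.mpr (hRR.trans (by simpa using neg_le_abs (-R'))))
    have h2 : -R' ∉ A := fun h => absurd (hAR _ h)
      (not_lt.mpr (hRR.trans (by simpa using neg_le_abs (-R'))))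
    simp only [hK, h1, h2, false_or, false_and, if_false, add_zero, hS]
    refine Finset.sum_eq_zero fun a ha => ?_
    rw [if_neg (not_lt.mpr _)]
    linarith [neg_abs_le a, hAR a ha]
  rw [e1, e2, sub_zero, intervalIntegral.integral_of_le hR0,
    setIntegral_indicator hO.measurableSet, inter_eq_right.mpr] at key
  · exact key
  · intro t ht
    have := abs_lt.mp (hOR t ht)
    exact ⟨by linarith, by linarith⟩

end Line

/-! ### Boundedness of the derivative of a `C¹` map on a compact set -/

section Bounded

/-- The bound holds on the interior only: elsewhere `fderiv` is unrelated to the derivative relative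
to `K`. -/
theorem ContDiffOn.exists_bound_fderiv_interior {E F : Type*} [NormedAddCommGroup E]
    [NormedSpace ℝ E] [NormedAddCommGroup F] [NormedSpace ℝ F] {K : Set E} {f : E → F}
    (hf : ContDiffOn ℝ 1 f K) (hK : IsCompact K) :
    ∃ C, ∀ z ∈ interior K, ‖fderiv ℝ f z‖ ≤ C := by
  refine hK.induction_on (p := fun s => ∃ C, ∀ z ∈ s ∩ interior K, ‖fderiv ℝ f z‖ ≤ C)
    ⟨0, by simp⟩ ?_ ?_ ?_ |>.imp fun C hC z hz => hC z ⟨interior_subset hz, hz⟩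
  · rintro s t hst ⟨C, hC⟩
    exact ⟨C, fun z hz => hC z ⟨hst hz.1, hz.2⟩⟩
  · rintro s t ⟨C, hC⟩ ⟨C', hC'⟩
    refine ⟨max C C', fun z hz => ?_⟩
    rcases hz.1 with h | h
    · exact (hC z ⟨h, hz.2⟩).trans (le_max_left _ _)
    · exact (hC' z ⟨h, hz.2⟩).trans (le_max_right _ _)
  · intro z hz
    have h := hf z hz
    rw [show (1 : WithTop ℕ∞) = 0 + 1 by simp,
      contDiffWithinAt_succ_iff_hasFDerivWithinAt (by simp), insert_eq_of_mem hz] at h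
    obtain ⟨u, hu, -, f', hf', hcont⟩ := h
    have hzu : z ∈ u := mem_of_mem_nhdsWithin hz hu
    have hc : ContinuousWithinAt f' u z := hcont.continuousWithinAt
    have hb : ∀ᶠ w in 𝓝[K] z, ‖f' w‖ < ‖f' z‖ + 1 := by
      have h1 : ∀ᶠ w in 𝓝[u] z, ‖f' w‖ < ‖f' z‖ + 1 :=
        hc.norm.eventually (gt_mem_nhds (lt_add_one _))
      exact h1.filter_mono (nhdsWithin_le_iff.mpr hu)
    obtain ⟨V, hVo, hzV, hV⟩ := mem_nhdsWithin.mp hu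
    refine ⟨_, hb.and (mem_nhdsWithin_of_mem_nhds (hVo.mem_nhds hzV)), ‖f' z‖ + 1, fun w hw => ?_⟩
    have hu' : u ∈ 𝓝 w := mem_of_superset
      (inter_mem (hVo.mem_nhds hw.1.2) (isOpen_interior.mem_nhds hw.2))
      fun y hy => hV ⟨hy.1, interior_subset hy.2⟩
    rw [((hf' w (mem_of_mem_nhds hu')).hasFDerivAt hu').fderiv]
    exact hw.1.1.le

end Bounded

/-! ### The boundary near a regular point -/

section LocalGeometry

variable {E F : Type*} [NormedAddCommGroup E] [NormedSpace ℝ E] [FiniteDimensional ℝ E]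
  [NormedAddCommGroup F] [InnerProductSpace ℝ F]

/-- A set which near `x u₀` is parametrized by an immersion `x` lies, close to this point, in any
given cone around the tangent space. -/
theorem eventually_abs_inner_sub_le_of_hasFDerivAt {x : E → F} {L : E →L[ℝ] F} {u₀ : E}
    (hx : HasFDerivAt x L u₀) (hL : Function.Injective L) {ν : F} (hν : ‖ν‖ = 1)
    (hνL : ∀ v, inner ℝ ν (L v) = 0) {B : Set F}
    (hB : ∀ r > 0, ∀ᶠ q in 𝓝 (x u₀), q ∈ B → ∃ u ∈ Metric.ball u₀ r, x u = q)
    {ε : ℝ} (hε : 0 < ε) :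
    ∀ᶠ q in 𝓝 (x u₀), q ∈ B → |inner ℝ ν (q - x u₀)| ≤ ε * ‖q - x u₀‖ := by
  obtain ⟨K, hK0, hK⟩ := (L : E →ₗ[ℝ] F).exists_antilipschitzWith (LinearMap.ker_eq_bot.mpr hL)
  have hKpos : (0 : ℝ) < K := by exact_mod_cast hK0
  have hKn : ∀ v, ‖v‖ ≤ K * ‖L v‖ := fun v => by simpa using hK.le_mul_dist v 0
  set δ : ℝ := min 1 ε / (2 * K) with hδ
  have hδpos : 0 < δ := div_pos (lt_min one_pos hε) (by positivity)
  have hδ1 : K * δ ≤ 1 / 2 := by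
    rw [hδ, mul_div_assoc', div_le_iff₀ (by positivity)]
    nlinarith [min_le_left 1 ε]
  have hδ2 : 2 * K * δ ≤ ε := by
    rw [hδ, mul_div_cancel₀ _ (by positivity)]
    exact min_le_right _ _
  obtain ⟨r, hr, hball⟩ := Metric.eventually_nhds_iff.mp (hx.isLittleO.def hδpos)
  filter_upwards [hB r hr] with q hq hqB
  obtain ⟨u, hu, rfl⟩ := hq hqB
  have h1 : ‖x u - x u₀ - L (u - u₀)‖ ≤ δ * ‖u - u₀‖ := hball hu
  have h2 : ‖L (u - u₀)‖ ≤ ‖x u - x u₀‖ + δ * ‖u - u₀‖ := by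
    have := norm_sub_norm_le (L (u - u₀)) (x u - x u₀)
    rw [norm_sub_rev (L _) (_ - _)] at this
    linarith
  have h3 : ‖u - u₀‖ ≤ 2 * K * ‖x u - x u₀‖ := by
    have := hKn (u - u₀)
    have h4 := mul_le_mul_of_nonneg_left h2 hKpos.le
    nlinarith [norm_nonneg (u - u₀)]
  have h5 : inner ℝ ν (x u - x u₀) = inner ℝ ν (x u - x u₀ - L (u - u₀)) := by
    rw [inner_sub_right _ _ (L _), hνL, sub_zero]
  calc |inner ℝ ν (x u - x u₀)| ≤ ‖ν‖ * ‖x u - x u₀ - L (u - u₀)‖ := by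
        rw [h5]; exact abs_real_inner_le_norm _ _
    _ ≤ δ * ‖u - u₀‖ := by rw [hν, one_mul]; exact h1
    _ ≤ δ * (2 * K * ‖x u - x u₀‖) := by gcongr
    _ = 2 * K * δ * ‖x u - x u₀‖ := by ring
    _ ≤ ε * ‖x u - x u₀‖ := by gcongr

/-- If near `p` the frontier of `D` stays in small cones around the hyperplane orthogonal to the
outer normal `ν`, then every direction `e` on the side of `ν` points out of `D` as `ν` does: the
segment from `p + t • ν` to `p + t • e` misses the frontier. -/
theorem eventually_notMem_closure_and_mem_of_inner_pos {D : Set F} (hD : IsOpen D) {p ν e : F}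
    (hν1 : ‖ν‖ = 1) (he1 : ‖e‖ ≤ 1) (hνe : 0 < inner ℝ ν e)
    (hν : ∀ᶠ t in 𝓝[>] (0 : ℝ), p + t • ν ∉ closure D ∧ p - t • ν ∈ D)
    (hcone : ∀ ε > 0, ∀ᶠ q in 𝓝 p, q ∈ frontier D → |inner ℝ ν (q - p)| ≤ ε * ‖q - p‖) :
    ∀ᶠ t in 𝓝[>] (0 : ℝ), p + t • e ∉ closure D ∧ p - t • e ∈ D := by
  set m := inner ℝ ν e with hm
  have hm1 : m ≤ 1 := by
    have := real_inner_le_norm ν e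
    rw [hν1, one_mul] at this
    exact this.trans he1
  obtain ⟨r, hr, hball⟩ := Metric.eventually_nhds_iff.mp (hcone (m / 2) (half_pos hνe))
  -- vectors of the segment from `ν` to `e` stay out of the cone
  have hseg : ∀ w ∈ segment ℝ ν e, m ≤ inner ℝ ν w ∧ ‖w‖ ≤ 1 := by
    rintro w ⟨a, b, ha, hb, hab, rfl⟩
    constructor
    · rw [inner_add_right, inner_smul_right, inner_smul_right, real_inner_self_eq_norm_sq, hν1]
      nlinarith
    · refine (norm_add_le _ _).trans ?_
      rw [norm_smul, norm_smul, Real.norm_of_nonneg ha, Real.norm_of_nonneg hb, hν1]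
      nlinarith
  have havoid : ∀ t : ℝ, t ≠ 0 → |t| < r → ∀ w ∈ segment ℝ ν e, p + t • w ∉ frontier D := by
    intro t ht htr w hw hmem
    obtain ⟨h1, h2⟩ := hseg w hw
    have hd : dist (p + t • w) p < r := by
      rw [dist_eq_norm, add_sub_cancel_left, norm_smul, Real.norm_eq_abs]
      nlinarith [abs_nonneg t, norm_nonneg w]
    have := hball hd hmem
    rw [add_sub_cancel_left, inner_smul_right, norm_smul, Real.norm_eq_abs, abs_mul,
      abs_of_nonneg (hνe.le.trans h1)] at this
    have htp : 0 < |t| := abs_pos.mpr ht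
    nlinarith [mul_le_mul_of_nonneg_left h1 htp.le, mul_le_mul_of_nonneg_left h2 htp.le,
      mul_pos htp hνe]
  -- so the segment from `p + t • ν` to `p + t • e` lies in `D` or outside of its closure
  have hside : ∀ t : ℝ, t ≠ 0 → |t| < r →
      (p + t • ν ∈ D ∧ p + t • e ∈ D) ∨ (p + t • ν ∉ closure D ∧ p + t • e ∉ closure D) := by
    intro t ht htr
    have hpre : IsPreconnected ((fun w => p + t • w) '' segment ℝ ν e) :=
      (convex_segment ν e).isPreconnected.image _ (by fun_prop)
    have hsub : (fun w => p + t • w) '' segment ℝ ν e ⊆ D ∪ (closure D)ᶜ := by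
      rintro _ ⟨w, hw, rfl⟩
      by_contra h
      rw [mem_union, not_or, notMem_compl_iff] at h
      exact havoid t ht htr w hw ⟨h.2, by rw [hD.interior_eq]; exact h.1⟩
    have hl := mem_image_of_mem (fun w => p + t • w) (left_mem_segment ℝ ν e)
    have hr := mem_image_of_mem (fun w => p + t • w) (right_mem_segment ℝ ν e)
    rcases hpre.subset_or_subset hD isClosed_closure.isOpen_compl
      (disjoint_compl_right.mono_left subset_closure) hsub with h | h
    · exact Or.inl ⟨h hl, h hr⟩
    · exact Or.inr ⟨h hl, h hr⟩
  filter_upwards [hν, Ioo_mem_nhdsGT hr] with t ht htr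
  have hta : |t| < r := by rw [abs_of_pos htr.1]; exact htr.2
  refine ⟨?_, ?_⟩
  · rcases hside t htr.1.ne' hta with h | h
    · exact absurd (subset_closure h.1) ht.1
    · exact h.2
  · have h' := hside (-t) (neg_ne_zero.mpr htr.1.ne') (by rwa [abs_neg])
    simp only [neg_smul, ← sub_eq_add_neg] at h'
    rcases h' with h | h
    · exact h.2
    · exact absurd (subset_closure ht.2) h.1

end LocalGeometry

namespace PiecewiseHypersurface

variable {n : ℕ} (S : PiecewiseHypersurface n)

/-- Near a point off the edges the hypersurface is the image of a small ball of parameters: by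
compactness the other pieces and the remaining parameters stay away. -/
theorem eventually_mem_carrier_imp {i : Fin S.len} {u₀ : EuclideanSpace ℝ (Fin n)}
    (hu₀ : u₀ ∈ interior (S.piece i).U) (hedge : (S.piece i).x u₀ ∉ S.edges) {r : ℝ}
    (hr : 0 < r) :
    ∀ᶠ q in 𝓝 ((S.piece i).x u₀), q ∈ S.carrier →
      ∃ u ∈ Metric.ball u₀ r, (S.piece i).x u = q := by
  have hint : ∀ j, ∀ v ∈ (S.piece j).U, (S.piece j).x v = (S.piece i).x u₀ →
      v ∈ interior (S.piece j).U := by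
    intro j v hv hvu
    by_contra hvi
    exact hedge (mem_iUnion.mpr ⟨j, v, ⟨subset_closure hv, hvi⟩, hvu⟩)
  have h1 : ∀ j, ∀ᶠ q in 𝓝 ((S.piece i).x u₀), j ≠ i → q ∉ (S.piece j).carrier := by
    intro j
    by_cases hji : j = i
    · simp [hji]
    have hc : IsClosed (S.piece j).carrier :=
      ((S.piece j).isCompact_U.image_of_continuousOn (S.piece j).contDiffOn_x.continuousOn).isClosed
    have hp : (S.piece i).x u₀ ∉ (S.piece j).carrier := by
      rintro ⟨v, hv, hvu⟩
      exact disjoint_left.mp (S.disjoint_interiors j i hji) ⟨v, hint j v hv hvu, hvu⟩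
        ⟨u₀, hu₀, rfl⟩
    filter_upwards [hc.isOpen_compl.mem_nhds hp] with q hq _
    exact hq
  have h2 : ∀ᶠ q in 𝓝 ((S.piece i).x u₀),
      q ∉ (S.piece i).x '' ((S.piece i).U \ Metric.ball u₀ r) := by
    have hc : IsClosed ((S.piece i).x '' ((S.piece i).U \ Metric.ball u₀ r)) :=
      (((S.piece i).isCompact_U.diff Metric.isOpen_ball).image_of_continuousOn
        ((S.piece i).contDiffOn_x.continuousOn.mono sdiff_subset)).isClosed
    refine hc.isOpen_compl.mem_nhds ?_
    rintro ⟨v, ⟨hv, hvb⟩, hvu⟩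
    exact hvb ((S.piece i).injOn_x (hint i v hv hvu) hu₀ hvu ▸ Metric.mem_ball_self hr)
  filter_upwards [eventually_all.mpr h1, h2] with q hq1 hq2 hq
  obtain ⟨j, hj⟩ := mem_iUnion.mp hq
  by_cases hji : j = i
  · subst hji
    obtain ⟨v, hv, rfl⟩ := hj
    refine ⟨v, ?_, rfl⟩
    by_contra hvb
    exact hq2 ⟨v, ⟨hv, hvb⟩, rfl⟩
  · exact absurd hj (hq1 j hji)

end PiecewiseHypersurface

/-! ### Slicing by lines parallel to a coordinate axis -/

section Coordinates

variable {n : ℕ}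

/-- The projection of `ℝⁿ⁺¹` to `ℝⁿ` that forgets the `i`-th coordinate. -/
noncomputable def dropCoord (i : Fin (n + 1)) :
    EuclideanSpace ℝ (Fin (n + 1)) →L[ℝ] EuclideanSpace ℝ (Fin n) :=
  LinearMap.toContinuousLinearMap
    { toFun := fun p => WithLp.toLp 2 fun k => p (i.succAbove k)
      map_add' := fun _ _ => rfl
      map_smul' := fun _ _ => rfl }

/-- The point of `ℝⁿ⁺¹` with `i`-th coordinate `t` and the remaining coordinates `y`: as a function
of `t`, the line parallel to the `i`-th axis over `y`. -/
def insertCoord (i : Fin (n + 1)) (y : EuclideanSpace ℝ (Fin n)) (t : ℝ) :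
    EuclideanSpace ℝ (Fin (n + 1)) :=
  WithLp.toLp 2 (i.insertNth t (fun k => y k))

@[simp] theorem dropCoord_apply (i : Fin (n + 1)) (p : EuclideanSpace ℝ (Fin (n + 1)))
    (k : Fin n) : dropCoord i p k = p (i.succAbove k) := rfl

@[simp] theorem insertCoord_apply_same (i : Fin (n + 1)) (y : EuclideanSpace ℝ (Fin n)) (t : ℝ) :
    insertCoord i y t i = t := by
  simp [insertCoord]

@[simp] theorem insertCoord_apply_succAbove (i : Fin (n + 1)) (y : EuclideanSpace ℝ (Fin n))
    (t : ℝ) (k : Fin n) : insertCoord i y t (i.succAbove k) = y k := by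
  simp [insertCoord]

@[simp] theorem dropCoord_insertCoord (i : Fin (n + 1)) (y : EuclideanSpace ℝ (Fin n)) (t : ℝ) :
    dropCoord i (insertCoord i y t) = y := by
  ext k; simp

theorem insertCoord_dropCoord (i : Fin (n + 1)) (p : EuclideanSpace ℝ (Fin (n + 1))) :
    insertCoord i (dropCoord i p) (p i) = p := by
  ext k
  induction k using Fin.succAboveCases i <;> simp

theorem insertCoord_add (i : Fin (n + 1)) (y : EuclideanSpace ℝ (Fin n)) (t s : ℝ) :
    insertCoord i y (t + s) = insertCoord i y t + s • EuclideanSpace.single i 1 := by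
  ext k
  induction k using Fin.succAboveCases i <;> simp

theorem continuous_insertCoord (i : Fin (n + 1)) :
    Continuous fun q : EuclideanSpace ℝ (Fin n) × ℝ => insertCoord i q.1 q.2 := by
  refine (PiLp.continuous_toLp 2 _).comp (continuous_pi fun k => ?_)
  induction k using Fin.succAboveCases i <;> simp <;> fun_prop

theorem hasDerivAt_insertCoord (i : Fin (n + 1)) (y : EuclideanSpace ℝ (Fin n)) (t : ℝ) :
    HasDerivAt (insertCoord i y) (EuclideanSpace.single i 1) t := by
  have h : insertCoord i y =
      fun t => insertCoord i y 0 + t • EuclideanSpace.single i (1 : ℝ) := by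
    funext t
    rw [← insertCoord_add, zero_add]
  rw [h]
  simpa using ((hasDerivAt_id t).smul_const (EuclideanSpace.single i (1 : ℝ))).const_add
    (insertCoord i y 0)

theorem measurePreserving_insertCoord (i : Fin (n + 1)) :
    MeasurePreserving (fun q : EuclideanSpace ℝ (Fin n) × ℝ => insertCoord i q.1 q.2)
      (volume.prod volume) volume := by
  have h1 := (volume_preserving_piFinSuccAbove (fun _ : Fin (n + 1) => ℝ) i).symm
  have h2 : MeasurePreserving (Prod.map id (WithLp.ofLp (p := 2)) :
      ℝ × EuclideanSpace ℝ (Fin n) → ℝ × (Fin n → ℝ)) (volume.prod volume)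
      (volume.prod volume) :=
    (MeasurePreserving.id volume).prod (PiLp.volume_preserving_ofLp (Fin n))
  have h3 : MeasurePreserving (Prod.swap : EuclideanSpace ℝ (Fin n) × ℝ → _)
    (volume.prod volume) (volume.prod volume) := Measure.measurePreserving_swap
  exact (PiLp.volume_preserving_toLp (Fin (n + 1))).comp (h1.comp (h2.comp h3))

theorem measurableEmbedding_insertCoord (i : Fin (n + 1)) :
    MeasurableEmbedding fun q : EuclideanSpace ℝ (Fin n) × ℝ => insertCoord i q.1 q.2 :=
  (continuous_insertCoord i).measurableEmbedding fun q q' h => by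
    have h1 := congrArg (dropCoord i) h
    have h2 := congrArg (fun p => p i) h
    simp only [dropCoord_insertCoord, insertCoord_apply_same] at h1 h2
    exact Prod.ext h1 h2

theorem setIntegral_eq_integral_setIntegral_insertCoord (i : Fin (n + 1))
    {D : Set (EuclideanSpace ℝ (Fin (n + 1)))} (hD : MeasurableSet D)
    {g : EuclideanSpace ℝ (Fin (n + 1)) → ℝ} (hg : IntegrableOn g D) :
    (∀ᵐ y, IntegrableOn (fun t => g (insertCoord i y t)) (insertCoord i y ⁻¹' D)) ∧
      ∫ p in D, g p = ∫ y, ∫ t in insertCoord i y ⁻¹' D, g (insertCoord i y t) := by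
  have hmeas : ∀ y, MeasurableSet (insertCoord i y ⁻¹' D) := fun y =>
    ((continuous_insertCoord i).comp (Continuous.prodMk_right y)).measurable hD
  have hint : Integrable (fun q : EuclideanSpace ℝ (Fin n) × ℝ =>
      D.indicator g (insertCoord i q.1 q.2)) (volume.prod volume) :=
    (measurePreserving_insertCoord i).integrable_comp_emb (measurableEmbedding_insertCoord i)
      |>.mpr ((integrable_indicator_iff hD).mpr hg)
  constructor
  · filter_upwards [hint.prod_right_ae] with y hy
    rw [← integrable_indicator_iff (hmeas y)]
    exact hy
  · rw [← integral_indicator hD, ← (measurePreserving_insertCoord i).integral_comp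
      (measurableEmbedding_insertCoord i), integral_prod _ hint]
    refine integral_congr_ae (Eventually.of_forall fun y => ?_)
    simp only
    rw [← integral_indicator (hmeas y)]
    rfl

end Coordinates

/-! ### The normal vector `N` of a parametrized surface -/

namespace ParametrizedSurface

variable {n : ℕ} (S : ParametrizedSurface n)

theorem det_dropCoord_comp_fderivWithin (i : Fin (n + 1)) (u : EuclideanSpace ℝ (Fin n)) :
    ((dropCoord i).comp (fderivWithin ℝ S.x S.U u)).det =
      ((S.jacobian u).submatrix i.succAbove id).det := by
  rw [ContinuousLinearMap.det, ← LinearMap.det_toMatrix (EuclideanSpace.basisFun (Fin n) ℝ).toBasis]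
  congr 1

theorem abs_normalVector_apply (i : Fin (n + 1)) (u : EuclideanSpace ℝ (Fin n)) :
    |S.normalVector u i| = |((dropCoord i).comp (fderivWithin ℝ S.x S.U u)).det| := by
  rw [det_dropCoord_comp_fderivWithin]
  simp [normalVector, abs_mul]

theorem normalVector_apply_eq_zero_iff (i : Fin (n + 1)) (u : EuclideanSpace ℝ (Fin n)) :
    S.normalVector u i = 0 ↔ ((dropCoord i).comp (fderivWithin ℝ S.x S.U u)).det = 0 := by
  rw [← abs_eq_zero, abs_normalVector_apply, abs_eq_zero]

/-- Expand a determinant whose first column repeats one of the others. -/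
theorem inner_normalVector_fderivWithin (u v : EuclideanSpace ℝ (Fin n)) :
    inner ℝ (S.normalVector u) (fderivWithin ℝ S.x S.U u v) = 0 := by
  have hbasis : ∀ j, inner ℝ (S.normalVector u)
      (fderivWithin ℝ S.x S.U u (EuclideanSpace.single j 1)) = 0 := by
    intro j
    let M : Matrix (Fin (n + 1)) (Fin (n + 1)) ℝ :=
      Matrix.of fun i => Fin.cons (S.jacobian u i j) (S.jacobian u i)
    have h0 : M.det = 0 :=
      Matrix.det_zero_of_column_eq (Fin.succ_ne_zero j).symm fun i => by simp [M]
    rw [Matrix.det_succ_column_zero] at h0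
    rw [PiLp.inner_apply, ← h0]
    refine Finset.sum_congr rfl fun i _ => ?_
    have hM : M.submatrix i.succAbove Fin.succ = (S.jacobian u).submatrix i.succAbove id := by
      ext k l
      simp [M]
    rw [hM]
    simp [M, normalVector, jacobian]
    ring
  have hv : v = ∑ j, v j • EuclideanSpace.single j (1 : ℝ) := by
    ext k
    simp [Pi.single_apply]
  rw [hv, map_sum, inner_sum]
  refine Finset.sum_eq_zero fun j _ => ?_
  rw [map_smul, inner_smul_right, hbasis, mul_zero]

/-- Where some `N k` is nonzero, the vectors orthogonal to the tangent space are the multiples of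
`N`: the difference of the two sides has vanishing `k`-th coordinate and is orthogonal to the tangent
space, which projects onto the other coordinates. -/
theorem smul_normalVector_eq_smul {u : EuclideanSpace ℝ (Fin n)} {k : Fin (n + 1)}
    (hk : S.normalVector u k ≠ 0) {ν : EuclideanSpace ℝ (Fin (n + 1))}
    (hν : ∀ v, inner ℝ ν (fderivWithin ℝ S.x S.U u v) = 0) :
    ν k • S.normalVector u = S.normalVector u k • ν := by
  set L := fderivWithin ℝ S.x S.U u
  set w := ν k • S.normalVector u - S.normalVector u k • ν with hw
  have hwk : w k = 0 := by simp [hw, mul_comm]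
  have hdet : ((dropCoord k).comp L).det ≠ 0 :=
    fun h => hk ((S.normalVector_apply_eq_zero_iff k u).mpr h)
  obtain ⟨v, hv⟩ := (((dropCoord k).comp L).toContinuousLinearEquivOfDetNeZero hdet).surjective
    (dropCoord k w)
  have hv' : dropCoord k (L v) = dropCoord k w := hv
  have h0 : inner ℝ w (L v) = 0 := by
    rw [hw, inner_sub_left, inner_smul_left, inner_smul_left, hν,
      inner_normalVector_fderivWithin]
    simp
  have hLv : ∀ l, L v (k.succAbove l) = w (k.succAbove l) := fun l => congrArg (fun q => q l) hv'
  rw [PiLp.inner_apply, Fin.sum_univ_succAbove _ k] at h0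
  simp only [hwk, hLv, inner_zero_left, zero_add, real_inner_self_eq_norm_sq] at h0
  rw [Finset.sum_eq_zero_iff_of_nonneg fun l _ => sq_nonneg _] at h0
  rw [← sub_eq_zero]
  change w = 0
  ext l
  induction l using Fin.succAboveCases k with
  | x => exact hwk
  | p l => simpa using h0 l (Finset.mem_univ l)

/-- The `i`-th component of the surface element is up to sign the Jacobian of the projection along
the `i`-th axis. -/
theorem apply_mul_norm_normalVector {u : EuclideanSpace ℝ (Fin n)}
    {ν : EuclideanSpace ℝ (Fin (n + 1))} (hν1 : ‖ν‖ = 1)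
    (hν : ∀ v, inner ℝ ν (fderivWithin ℝ S.x S.U u v) = 0) (i : Fin (n + 1)) :
    ν i * ‖S.normalVector u‖ = SignType.sign (ν i) * |S.normalVector u i| := by
  have key : |ν i| * ‖S.normalVector u‖ = |S.normalVector u i| := by
    by_cases hN : S.normalVector u = 0
    · simp [hN]
    obtain ⟨k, hk⟩ : ∃ k, S.normalVector u k ≠ 0 := by
      by_contra! h
      exact hN (by ext k; simpa using h k)
    have h := S.smul_normalVector_eq_smul hk hν
    have h1 := congrArg norm h
    have h2 := congrArg (fun q => |q i|) h
    simp only [norm_smul, hν1, Real.norm_eq_abs, mul_one] at h1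
    simp only [PiLp.smul_apply, smul_eq_mul, abs_mul] at h2
    refine mul_left_cancel₀ (abs_ne_zero.mpr hk) ?_
    rw [← mul_assoc, ← h2, ← h1]
    ring
  rw [← key, ← mul_assoc, sign_mul_abs]

theorem hasFDerivAt_x {u : EuclideanSpace ℝ (Fin n)} (hu : u ∈ interior S.U) :
    HasFDerivAt S.x (fderivWithin ℝ S.x S.U u) u := by
  have hU : S.U ∈ 𝓝 u := mem_interior_iff_mem_nhds.mp hu
  exact ((S.contDiffOn_x.differentiableOn one_ne_zero u
    (interior_subset hu)).hasFDerivWithinAt).hasFDerivAt hU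

theorem hasFDerivAt_dropCoord_x (i : Fin (n + 1)) {u : EuclideanSpace ℝ (Fin n)}
    (hu : u ∈ interior S.U) :
    HasFDerivAt (fun u => dropCoord i (S.x u))
      ((dropCoord i).comp (fderivWithin ℝ S.x S.U u)) u :=
  (dropCoord i).hasFDerivAt.comp u (S.hasFDerivAt_x hu)

theorem fderivWithin_injective_of_normalVector_ne_zero {u : EuclideanSpace ℝ (Fin n)}
    {i : Fin (n + 1)} (hN : S.normalVector u i ≠ 0) :
    Function.Injective (fderivWithin ℝ S.x S.U u) := by
  have hdet : ((dropCoord i).comp (fderivWithin ℝ S.x S.U u)).det ≠ 0 :=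
    fun h => hN ((S.normalVector_apply_eq_zero_iff i u).mpr h)
  have h := (((dropCoord i).comp (fderivWithin ℝ S.x S.U
    u)).toContinuousLinearEquivOfDetNeZero hdet).injective
  intro v w hvw
  exact h (congrArg (dropCoord i) hvw)

theorem continuousOn_fderivWithin_interior :
    ContinuousOn (fderivWithin ℝ S.x S.U) (interior S.U) := by
  refine ((S.contDiffOn_x.mono interior_subset).continuousOn_fderiv_of_isOpen isOpen_interior
    le_rfl).congr fun u hu => (S.hasFDerivAt_x hu).fderiv.symm

theorem continuousOn_abs_normalVector_apply (i : Fin (n + 1)) :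
    ContinuousOn (fun u => |S.normalVector u i|) (interior S.U) := by
  simp only [abs_normalVector_apply]
  exact (ContinuousLinearMap.continuous_det.comp_continuousOn
    (continuousOn_const.clm_comp S.continuousOn_fderivWithin_interior)).abs

theorem exists_abs_normalVector_apply_le (i : Fin (n + 1)) :
    ∃ C, ∀ u ∈ interior S.U, |S.normalVector u i| ≤ C := by
  obtain ⟨C, hC⟩ := S.contDiffOn_x.exists_bound_fderiv_interior S.isCompact_U
  have : ProperSpace (EuclideanSpace ℝ (Fin n) →L[ℝ] EuclideanSpace ℝ (Fin (n + 1))) :=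
    FiniteDimensional.proper ℝ _
  have hcont : Continuous fun L : EuclideanSpace ℝ (Fin n) →L[ℝ] EuclideanSpace ℝ (Fin (n + 1)) =>
      ((dropCoord i).comp L).det :=
    ContinuousLinearMap.continuous_det.comp (continuous_const.clm_comp continuous_id)
  obtain ⟨C', hC'⟩ := (isCompact_closedBall (0 : EuclideanSpace ℝ (Fin n) →L[ℝ]
    EuclideanSpace ℝ (Fin (n + 1))) C).exists_bound_of_continuousOn hcont.continuousOn
  refine ⟨C', fun u hu => ?_⟩
  rw [abs_normalVector_apply]
  refine hC' _ (mem_closedBall_zero_iff.mpr ?_)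
  rw [← (S.hasFDerivAt_x hu).fderiv]
  exact hC u hu

theorem interior_U_ae_eq : (interior S.U : Set (EuclideanSpace ℝ (Fin n))) =ᵐ[volume] S.U :=
  interior_ae_eq_of_null_frontier S.volume_frontier_U

theorem restrict_interior_U : volume.restrict (interior S.U) = volume.restrict S.U :=
  Measure.restrict_congr_set S.interior_U_ae_eq

/-- The subset of the parameter domain where the surface is transversal to the `i`-th axis. -/
def transversalSet (i : Fin (n + 1)) : Set (EuclideanSpace ℝ (Fin n)) :=
  {u ∈ interior S.U | S.normalVector u i ≠ 0}

theorem isOpen_transversalSet (i : Fin (n + 1)) : IsOpen (S.transversalSet i) := by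
  have h := (S.continuousOn_abs_normalVector_apply i).isOpen_inter_preimage isOpen_interior
    (isOpen_compl_singleton (x := (0 : ℝ)))
  convert h using 1
  ext u
  simp [transversalSet]

theorem volume_dropCoord_image_frontier (i : Fin (n + 1)) :
    volume ((fun u => dropCoord i (S.x u)) '' frontier S.U) = 0 := by
  refine addHaar_image_eq_zero_of_differentiableOn_of_addHaar_eq_zero volume ?_
    S.volume_frontier_U
  exact (dropCoord i).differentiable.comp_differentiableOn
    ((S.contDiffOn_x.differentiableOn one_ne_zero).mono S.isCompact_U.isClosed.frontier_subset)

/-- The equidimensional case of Sard's theorem. -/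
theorem volume_dropCoord_image_critical (i : Fin (n + 1)) :
    volume ((fun u => dropCoord i (S.x u)) '' {u ∈ interior S.U | S.normalVector u i = 0}) = 0 :=
  addHaar_image_eq_zero_of_det_fderivWithin_eq_zero volume
    (fun _ hu => (S.hasFDerivAt_dropCoord_x i hu.1).hasFDerivWithinAt)
    fun u hu => (S.normalVector_apply_eq_zero_iff i u).mp hu.2

theorem integrableOn_abs_normalVector_mul (i : Fin (n + 1))
    {h : EuclideanSpace ℝ (Fin n) → ℝ} (hm : AEStronglyMeasurable h (volume.restrict S.U))
    {C : ℝ} (hC : ∀ u ∈ S.U, |h u| ≤ C) :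
    IntegrableOn (fun u => |S.normalVector u i| * h u) S.U := by
  obtain ⟨C', hC'⟩ := S.exists_abs_normalVector_apply_le i
  rw [IntegrableOn, ← restrict_interior_U] at *
  have hfin : volume (interior S.U) < ⊤ :=
    (measure_mono interior_subset).trans_lt S.isCompact_U.measure_lt_top
  refine IntegrableOn.of_bound hfin
    (((S.continuousOn_abs_normalVector_apply i).aestronglyMeasurable
      isOpen_interior.measurableSet).mul hm) (C' * C) ?_
  filter_upwards [ae_restrict_mem isOpen_interior.measurableSet] with u hu
  rw [norm_mul, Real.norm_eq_abs, Real.norm_eq_abs, abs_abs]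
  exact mul_le_mul (hC' u hu) (hC u (interior_subset hu)) (abs_nonneg _)
    ((abs_nonneg _).trans (hC' u hu))

end ParametrizedSurface

/-! ### Crossings of the boundary in a coordinate direction -/

section ExitSign

variable {n : ℕ}

open Classical in
/-- The sign with which the line through `p` in the `i`-th coordinate direction crosses the boundary
of `D`: it is `1` if the line leaves `D` at `p` and `-1` if it enters `D` there. The direction `-eᵢ`
is written as a vector so that both sides have the form `p + t • e`. The definition by sides outside
of `D` makes the function Borel measurable. -/
noncomputable def exitSign (D : Set (EuclideanSpace ℝ (Fin n))) (i : Fin n)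
    (p : EuclideanSpace ℝ (Fin n)) : ℝ :=
  (if ∀ᶠ t in 𝓝[>] (0 : ℝ), p + t • EuclideanSpace.single i 1 ∉ D then 1 else 0) -
    if ∀ᶠ t in 𝓝[>] (0 : ℝ), p + t • -EuclideanSpace.single i 1 ∉ D then 1 else 0

theorem measurableSet_eventually_add_smul_notMem {E : Type*} [NormedAddCommGroup E]
    [NormedSpace ℝ E] [MeasurableSpace E] [BorelSpace E] {D : Set E} (hD : IsOpen D) (e : E) :
    MeasurableSet {p | ∀ᶠ t in 𝓝[>] (0 : ℝ), p + t • e ∉ D} := by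
  -- a countable union of closed sets
  have h : {p | ∀ᶠ t in 𝓝[>] (0 : ℝ), p + t • e ∉ D} =
      ⋃ k : ℕ, ⋂ t ∈ Ioo (0 : ℝ) (1 / (k + 1)), {p | p + t • e ∉ D} := by
    ext p
    simp only [mem_ofPred_eq, mem_iUnion, mem_iInter]
    constructor
    · intro h
      obtain ⟨r, hr, h⟩ := mem_nhdsGT_iff_exists_Ioo_subset.mp h
      obtain ⟨k, hk⟩ := exists_nat_one_div_lt (show (0 : ℝ) < r from hr)
      exact ⟨k, fun t ht => h ⟨ht.1, ht.2.trans hk⟩⟩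
    · rintro ⟨k, hk⟩
      filter_upwards [Ioo_mem_nhdsGT (show (0 : ℝ) < 1 / (k + 1) by positivity)] with t ht
      exact hk t ht
  rw [h]
  refine MeasurableSet.iUnion fun k => (isClosed_biInter fun t _ => ?_).measurableSet
  exact hD.isClosed_compl.preimage (continuous_id.add continuous_const)

theorem measurable_exitSign {D : Set (EuclideanSpace ℝ (Fin n))} (hD : IsOpen D) (i : Fin n) :
    Measurable (exitSign D i) :=
  (Measurable.ite (measurableSet_eventually_add_smul_notMem hD _) measurable_const
    measurable_const).sub
    (Measurable.ite (measurableSet_eventually_add_smul_notMem hD _) measurable_const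
      measurable_const)

theorem abs_exitSign_le_one (D : Set (EuclideanSpace ℝ (Fin n))) (i : Fin n)
    (p : EuclideanSpace ℝ (Fin n)) : |exitSign D i p| ≤ 1 := by
  unfold exitSign
  split_ifs <;> simp

theorem exitSign_eq_one {D : Set (EuclideanSpace ℝ (Fin n))} {i : Fin n}
    {p : EuclideanSpace ℝ (Fin n)}
    (h1 : ∀ᶠ t in 𝓝[>] (0 : ℝ), p + t • EuclideanSpace.single i 1 ∉ D)
    (h2 : ∀ᶠ t in 𝓝[>] (0 : ℝ), p + t • -EuclideanSpace.single i 1 ∈ D) :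
    exitSign D i p = 1 := by
  rw [exitSign, if_pos h1, if_neg (Eventually.frequently h2), sub_zero]

theorem exitSign_eq_neg_one {D : Set (EuclideanSpace ℝ (Fin n))} {i : Fin n}
    {p : EuclideanSpace ℝ (Fin n)}
    (h1 : ∀ᶠ t in 𝓝[>] (0 : ℝ), p + t • EuclideanSpace.single i 1 ∈ D)
    (h2 : ∀ᶠ t in 𝓝[>] (0 : ℝ), p + t • -EuclideanSpace.single i 1 ∉ D) :
    exitSign D i p = -1 := by
  rw [exitSign, if_pos h2, if_neg (Eventually.frequently h1), zero_sub]

end ExitSign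

namespace PiecewiseHypersurface

variable {n : ℕ} {S : PiecewiseHypersurface n}

/-- At a point off the edges where the surface is transversal to the `i`-th axis, the line in this
direction passes from `D` to the exterior or back, according to the sign of the component `νᵢ`. -/
theorem IsUnitOuterNormalField.crossing {D : Set (EuclideanSpace ℝ (Fin (n + 1)))}
    (hD : IsOpen D) (hS : S.carrier = frontier D)
    {ν : EuclideanSpace ℝ (Fin (n + 1)) → EuclideanSpace ℝ (Fin (n + 1))}
    (hν : S.IsUnitOuterNormalField D ν) {j : Fin S.len} {u : EuclideanSpace ℝ (Fin n)}
    (hu : u ∈ interior (S.piece j).U) (hedge : (S.piece j).x u ∉ S.edges) {i : Fin (n + 1)}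
    (hN : (S.piece j).normalVector u i ≠ 0) :
    (0 < ν ((S.piece j).x u) i ∧
      (∀ᶠ t in 𝓝[>] (0 : ℝ), (S.piece j).x u + t • EuclideanSpace.single i 1 ∉ closure D) ∧
      ∀ᶠ t in 𝓝[>] (0 : ℝ), (S.piece j).x u + t • -EuclideanSpace.single i 1 ∈ D) ∨
    (ν ((S.piece j).x u) i < 0 ∧
      (∀ᶠ t in 𝓝[>] (0 : ℝ), (S.piece j).x u + t • EuclideanSpace.single i 1 ∈ D) ∧
      ∀ᶠ t in 𝓝[>] (0 : ℝ), (S.piece j).x u + t • -EuclideanSpace.single i 1 ∉ closure D) := by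
  obtain ⟨hν1, hν2, hν3⟩ := hν j u hu hedge
  set p := (S.piece j).x u
  have hcone : ∀ ε > 0, ∀ᶠ q in 𝓝 p, q ∈ frontier D → |inner ℝ (ν p) (q - p)| ≤ ε * ‖q - p‖ :=
    fun ε hε => eventually_abs_inner_sub_le_of_hasFDerivAt ((S.piece j).hasFDerivAt_x hu)
      ((S.piece j).fderivWithin_injective_of_normalVector_ne_zero hN) hν1 hν2
      (fun r hr => hS ▸ S.eventually_mem_carrier_imp hu hedge hr) hε
  have hne : ν p i ≠ 0 := by
    intro h0
    have h := (S.piece j).smul_normalVector_eq_smul hN hν2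
    rw [h0, zero_smul, eq_comm, smul_eq_zero, or_iff_right hN] at h
    simp [h] at hν1
  have hside : ∀ e : EuclideanSpace ℝ (Fin (n + 1)), ‖e‖ ≤ 1 → 0 < inner ℝ (ν p) e →
      (∀ᶠ t in 𝓝[>] (0 : ℝ), p + t • e ∉ closure D) ∧ ∀ᶠ t in 𝓝[>] (0 : ℝ), p + t • -e ∈ D := by
    intro e he1 he
    have h := eventually_notMem_closure_and_mem_of_inner_pos hD hν1 he1 he hν3 hcone
    refine ⟨h.mono fun t ht => ht.1, h.mono fun t ht => ?_⟩
    rw [smul_neg, ← sub_eq_add_neg]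
    exact ht.2
  rcases lt_or_gt_of_ne hne with h | h
  · right
    have := hside (-EuclideanSpace.single i 1) (by simp)
      (by simpa [EuclideanSpace.inner_single_right] using h)
    rw [neg_neg] at this
    exact ⟨h, this.2, this.1⟩
  · left
    exact ⟨h, hside (EuclideanSpace.single i 1) (by simp)
      (by simpa [EuclideanSpace.inner_single_right] using h)⟩

theorem IsUnitOuterNormalField.exitSign_eq_sign {D : Set (EuclideanSpace ℝ (Fin (n + 1)))}
    (hD : IsOpen D) (hS : S.carrier = frontier D)
    {ν : EuclideanSpace ℝ (Fin (n + 1)) → EuclideanSpace ℝ (Fin (n + 1))}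
    (hν : S.IsUnitOuterNormalField D ν) {j : Fin S.len} {u : EuclideanSpace ℝ (Fin n)}
    (hu : u ∈ interior (S.piece j).U) (hedge : (S.piece j).x u ∉ S.edges) {i : Fin (n + 1)}
    (hN : (S.piece j).normalVector u i ≠ 0) :
    exitSign D i ((S.piece j).x u) = SignType.sign (ν ((S.piece j).x u) i) := by
  rcases hν.crossing hD hS hu hedge hN with ⟨h0, h1, h2⟩ | ⟨h0, h1, h2⟩
  · rw [exitSign_eq_one (h1.mono fun t ht hD => ht (subset_closure hD)) h2, sign_pos h0]; rfl
  · rw [exitSign_eq_neg_one h1 (h2.mono fun t ht hD => ht (subset_closure hD)), sign_neg h0]; rfl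

end PiecewiseHypersurface

/-! ### Almost every line is transversal -/

namespace PiecewiseHypersurface

variable {n : ℕ} {S : PiecewiseHypersurface n}
  {D : Set (EuclideanSpace ℝ (Fin (n + 1)))}
  {ν : EuclideanSpace ℝ (Fin (n + 1)) → EuclideanSpace ℝ (Fin (n + 1))}

/-- The line parallel to the `i`-th axis over `y` meets `S` only in points off the edges, and there
transversally. -/
def IsTransversalLine (S : PiecewiseHypersurface n) (i : Fin (n + 1))
    (y : EuclideanSpace ℝ (Fin n)) : Prop :=
  ∀ t, ∀ j, ∀ u ∈ (S.piece j).U, (S.piece j).x u = insertCoord i y t →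
    u ∈ (S.piece j).transversalSet i

theorem ae_isTransversalLine (S : PiecewiseHypersurface n) (i : Fin (n + 1)) :
    ∀ᵐ y, S.IsTransversalLine i y := by
  have h1 : ∀ᵐ y, ∀ j, y ∉ (fun u => dropCoord i ((S.piece j).x u)) '' frontier (S.piece j).U :=
    ae_all_iff.mpr fun j => measure_eq_zero_iff_ae_notMem.mp
      ((S.piece j).volume_dropCoord_image_frontier i)
  have h2 : ∀ᵐ y, ∀ j, y ∉ (fun u => dropCoord i ((S.piece j).x u)) ''
      {u ∈ interior (S.piece j).U | (S.piece j).normalVector u i = 0} :=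
    ae_all_iff.mpr fun j => measure_eq_zero_iff_ae_notMem.mp
      ((S.piece j).volume_dropCoord_image_critical i)
  filter_upwards [h1, h2] with y h1 h2 t j u hu hut
  have hy : dropCoord i ((S.piece j).x u) = y := by rw [hut, dropCoord_insertCoord]
  have hui : u ∈ interior (S.piece j).U := by
    by_contra h
    exact h1 j ⟨u, ⟨subset_closure hu, h⟩, hy⟩
  exact ⟨hui, fun h => h2 j ⟨u, ⟨hui, h⟩, hy⟩⟩

theorem IsTransversalLine.notMem_edges {i : Fin (n + 1)} {y : EuclideanSpace ℝ (Fin n)}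
    (hy : S.IsTransversalLine i y) (t : ℝ) : insertCoord i y t ∉ S.edges := by
  intro h
  obtain ⟨j, u, hu, hut⟩ := mem_iUnion.mp h
  exact hu.2 (hy t j u ((S.piece j).isCompact_U.isClosed.frontier_subset hu) hut).1

theorem IsTransversalLine.exitSign_of_mem_carrier {i : Fin (n + 1)} {y : EuclideanSpace ℝ (Fin n)}
    (hy : S.IsTransversalLine i y) (hD : IsOpen D) (hS : S.carrier = frontier D)
    (hν : S.IsUnitOuterNormalField D ν) {a : ℝ} (ha : insertCoord i y a ∈ S.carrier) :
    (exitSign D i (insertCoord i y a) = 1 ∧ (∀ᶠ t in 𝓝[<] a, insertCoord i y t ∈ D) ∧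
      ∀ᶠ t in 𝓝[>] a, insertCoord i y t ∉ closure D) ∨
    (exitSign D i (insertCoord i y a) = -1 ∧ (∀ᶠ t in 𝓝[<] a, insertCoord i y t ∉ closure D) ∧
      ∀ᶠ t in 𝓝[>] a, insertCoord i y t ∈ D) := by
  obtain ⟨j, u, hu, hua⟩ := mem_iUnion.mp ha
  obtain ⟨hui, hN⟩ := hy a j u hu hua
  have hright : ∀ P : EuclideanSpace ℝ (Fin (n + 1)) → Prop,
      (∀ᶠ t in 𝓝[>] (0 : ℝ), P (insertCoord i y a + t • EuclideanSpace.single i 1)) →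
      ∀ᶠ t in 𝓝[>] a, P (insertCoord i y t) := by
    intro P h
    have ht : Tendsto (fun t => t - a) (𝓝[>] a) (𝓝[>] 0) := by
      refine tendsto_nhdsWithin_of_tendsto_nhds_of_eventually_within _ ?_ ?_
      · exact ((continuous_sub_right a).tendsto' a 0 (sub_self a)).mono_left nhdsWithin_le_nhds
      · filter_upwards [self_mem_nhdsWithin] with t (ht : a < t)
        exact sub_pos.mpr ht
    filter_upwards [ht.eventually h] with t ht
    rwa [← insertCoord_add, add_sub_cancel] at ht
  have hleft : ∀ P : EuclideanSpace ℝ (Fin (n + 1)) → Prop,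
      (∀ᶠ t in 𝓝[>] (0 : ℝ), P (insertCoord i y a + t • -EuclideanSpace.single i 1)) →
      ∀ᶠ t in 𝓝[<] a, P (insertCoord i y t) := by
    intro P h
    have ht : Tendsto (fun t => a - t) (𝓝[<] a) (𝓝[>] 0) := by
      refine tendsto_nhdsWithin_of_tendsto_nhds_of_eventually_within _ ?_ ?_
      · exact ((continuous_sub_left a).tendsto' a 0 (sub_self a)).mono_left nhdsWithin_le_nhds
      · filter_upwards [self_mem_nhdsWithin] with t (ht : t < a)
        exact sub_pos.mpr ht
    filter_upwards [ht.eventually h] with t ht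
    rwa [smul_neg, ← neg_smul, ← insertCoord_add, ← sub_eq_add_neg, sub_sub_cancel] at ht
  have hedge : (S.piece j).x u ∉ S.edges := hua ▸ hy.notMem_edges a
  rcases hν.crossing hD hS hui hedge hN with ⟨-, h1, h2⟩ | ⟨-, h1, h2⟩
  · rw [hua] at h1 h2
    exact Or.inl ⟨exitSign_eq_one (h1.mono fun t ht hD => ht (subset_closure hD)) h2,
      hleft (· ∈ D) h2, hright (· ∉ closure D) h1⟩
  · rw [hua] at h1 h2
    exact Or.inr ⟨exitSign_eq_neg_one h1 (h2.mono fun t ht hD => ht (subset_closure hD)),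
      hleft (· ∉ closure D) h2, hright (· ∈ D) h1⟩

/-- The crossings form a compact set and are isolated. -/
theorem IsTransversalLine.finite_carrier {i : Fin (n + 1)} {y : EuclideanSpace ℝ (Fin n)}
    (hy : S.IsTransversalLine i y) (hD : IsOpen D) (hDb : Bornology.IsBounded D)
    (hS : S.carrier = frontier D) (hν : S.IsUnitOuterNormalField D ν) :
    {t | insertCoord i y t ∈ S.carrier}.Finite := by
  set A := {t | insertCoord i y t ∈ S.carrier} with hA
  have hline : Continuous (insertCoord i y) :=
    (continuous_insertCoord i).comp (Continuous.prodMk_right y)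
  have hcl : IsClosed A := by
    rw [hA, hS]
    exact isClosed_frontier.preimage hline
  have hcpt : IsCompact A := by
    refine Metric.isCompact_of_isClosed_isBounded hcl ?_
    have hcptf : IsCompact (frontier D) := hDb.isCompact_closure.of_isClosed_subset
      isClosed_frontier frontier_subset_closure
    refine ((hcptf.image (EuclideanSpace.proj (𝕜 := ℝ) i).continuous).isBounded).subset ?_
    intro t ht
    exact ⟨insertCoord i y t, hS ▸ ht, by simp⟩
  refine hcpt.induction_on (p := Set.Finite) finite_empty (fun s t hst ht => ht.subset hst)
    (fun s t hs ht => hs.union ht) fun a ha => ?_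
  -- next to a crossing the line runs in `D` on one side and outside on the other
  have hne : ∀ᶠ t in 𝓝[≠] a, t ∉ A := by
    have hin : ∀ t, insertCoord i y t ∈ D → t ∉ A := fun t ht htA =>
      (show insertCoord i y t ∈ frontier D from hS ▸ htA).2 (by rwa [hD.interior_eq])
    have hout : ∀ t, insertCoord i y t ∉ closure D → t ∉ A := fun t ht htA =>
      ht (show insertCoord i y t ∈ frontier D from hS ▸ htA).1
    rw [← Iio_union_Ioi, nhdsWithin_union, eventually_sup]
    rcases hy.exitSign_of_mem_carrier hD hS hν ha with ⟨-, h1, h2⟩ | ⟨-, h1, h2⟩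
    · exact ⟨h1.mono hin, h2.mono hout⟩
    · exact ⟨h1.mono hout, h2.mono hin⟩
  refine ⟨{a}, ?_, finite_singleton a⟩
  rw [mem_nhdsWithin_iff_eventually]
  filter_upwards [eventually_nhdsWithin_iff.mp hne] with t ht htA
  by_contra h
  exact ht h htA

theorem IsTransversalLine.setIntegral_eq_sum {i : Fin (n + 1)} {y : EuclideanSpace ℝ (Fin n)}
    (hy : S.IsTransversalLine i y) (hD : IsOpen D) (hDb : Bornology.IsBounded D)
    (hS : S.carrier = frontier D) (hν : S.IsUnitOuterNormalField D ν)
    {f : EuclideanSpace ℝ (Fin (n + 1)) → ℝ} (hf : ContinuousOn f (closure D))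
    (hfd : DifferentiableOn ℝ f D)
    (hint : IntegrableOn (fun t => fderiv ℝ f (insertCoord i y t) (EuclideanSpace.single i 1))
      (insertCoord i y ⁻¹' D)) {A : Finset ℝ} (hA : ∀ t, t ∈ A ↔ insertCoord i y t ∈ S.carrier) :
    ∫ t in insertCoord i y ⁻¹' D, fderiv ℝ f (insertCoord i y t) (EuclideanSpace.single i 1) =
      ∑ t ∈ A, exitSign D i (insertCoord i y t) * f (insertCoord i y t) := by
  have hline : Continuous (insertCoord i y) :=
    (continuous_insertCoord i).comp (Continuous.prodMk_right y)
  have hO : IsOpen (insertCoord i y ⁻¹' D) := hD.preimage hline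
  have hOb : Bornology.IsBounded (insertCoord i y ⁻¹' D) := by
    refine ((hDb.isCompact_closure.image
      (EuclideanSpace.proj (𝕜 := ℝ) i).continuous).isBounded).subset fun t ht => ?_
    exact ⟨insertCoord i y t, subset_closure ht, by simp⟩
  refine setIntegral_deriv_eq_sum_of_finite_frontier hO hOb (f := fun t => f (insertCoord i y t))
    (σ := fun t => exitSign D i (insertCoord i y t)) ?_ ?_ ?_ hint ?_
  · intro t ht
    exact (hA t).mpr (hS ▸ hline.frontier_preimage_subset D ht)
  · exact hf.comp hline.continuousOn fun t ht => hline.closure_preimage_subset D ht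
  · intro t ht
    have hd : HasFDerivAt f (fderiv ℝ f (insertCoord i y t)) (insertCoord i y t) :=
      (hfd.differentiableAt (hD.mem_nhds ht)).hasFDerivAt
    exact hd.comp_hasDerivAt t (hasDerivAt_insertCoord i y t)
  · intro a ha
    rcases hy.exitSign_of_mem_carrier hD hS hν ((hA a).mp ha) with ⟨h0, h1, h2⟩ | ⟨h0, h1, h2⟩
    · exact Or.inl ⟨h0, h1, h2.mono fun t ht h => ht (subset_closure h)⟩
    · exact Or.inr ⟨h0, h1.mono fun t ht h => ht (subset_closure h), h2⟩

/-- The crossings of a transversal line, sorted by the pieces on which they lie. -/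
theorem IsTransversalLine.sum_tsum_fibre_eq {i : Fin (n + 1)} {y : EuclideanSpace ℝ (Fin n)}
    (hy : S.IsTransversalLine i y) (h : EuclideanSpace ℝ (Fin (n + 1)) → ℝ) {A : Finset ℝ}
    (hA : ∀ t, t ∈ A ↔ insertCoord i y t ∈ S.carrier) :
    ∑ j, ∑' u : ↥((S.piece j).transversalSet i ∩ (fun u => dropCoord i ((S.piece j).x u)) ⁻¹' {y}),
      h ((S.piece j).x u) = ∑ t ∈ A, h (insertCoord i y t) := by
  classical
  let T : Fin S.len → ℝ → Prop := fun j t =>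
    ∃ u ∈ (S.piece j).transversalSet i, (S.piece j).x u = insertCoord i y t
  have hpiece : ∀ j, ∑' u : ↥((S.piece j).transversalSet i ∩
      (fun u => dropCoord i ((S.piece j).x u)) ⁻¹' {y}), h ((S.piece j).x u) =
      ∑ t ∈ A, if T j t then h (insertCoord i y t) else 0 := by
    intro j
    set B := (S.piece j).transversalSet i ∩ (fun u => dropCoord i ((S.piece j).x u)) ⁻¹' {y}
    let τ : EuclideanSpace ℝ (Fin n) → ℝ := fun u => (S.piece j).x u i
    have hτ : ∀ u ∈ B, insertCoord i y (τ u) = (S.piece j).x u := fun u hu => by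
      have hu2 : dropCoord i ((S.piece j).x u) = y := hu.2
      rw [← hu2]
      exact insertCoord_dropCoord i _
    have hinj : InjOn τ B := fun u hu v hv huv =>
      (S.piece j).injOn_x hu.1.1 hv.1.1 (by rw [← hτ u hu, ← hτ v hv, huv])
    have himage : τ '' B = ↑(A.filter (T j)) := by
      ext t
      rw [Finset.coe_filter, mem_ofPred_eq]
      constructor
      · rintro ⟨u, hu, rfl⟩
        refine ⟨(hA _).mpr ?_, u, hu.1, (hτ u hu).symm⟩
        rw [hτ u hu]
        exact mem_iUnion.mpr ⟨j, u, interior_subset hu.1.1, rfl⟩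
      · rintro ⟨-, u, hu, hut⟩
        have hB : u ∈ B := ⟨hu, by simp [hut]⟩
        exact ⟨u, hB, by simp [τ, hut]⟩
    rw [← Finset.sum_filter, ← Finset.tsum_subtype' (A.filter (T j)), ← himage,
      tsum_image (fun t => h (insertCoord i y t)) hinj]
    exact tsum_congr fun u => by rw [hτ u u.2]
  simp only [hpiece]
  rw [Finset.sum_comm]
  refine Finset.sum_congr rfl fun t ht => ?_
  obtain ⟨j, u, hu, hut⟩ := mem_iUnion.mp ((hA t).mp ht)
  have huT := hy t j u hu hut
  rw [Finset.sum_eq_single j, if_pos ⟨u, huT, hut⟩]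
  · intro k _ hkj
    rw [if_neg]
    rintro ⟨v, hv, hvt⟩
    exact disjoint_left.mp (S.disjoint_interiors k j hkj) ⟨v, hv.1, hvt⟩ ⟨u, huT.1, hut⟩
  · exact fun hj => absurd (Finset.mem_univ j) hj

/-! ### Integration over the lines in a fixed direction -/

theorem integrableOn_abs_normalVector_mul_exitSign (hD : IsOpen D) (hDb : Bornology.IsBounded D)
    (hS : S.carrier = frontier D) {f : EuclideanSpace ℝ (Fin (n + 1)) → ℝ}
    (hf : ContinuousOn f (closure D)) (i : Fin (n + 1)) (j : Fin S.len) :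
    IntegrableOn (fun u => |(S.piece j).normalVector u i| *
      (exitSign D i ((S.piece j).x u) * f ((S.piece j).x u))) (S.piece j).U := by
  have hmaps : MapsTo (S.piece j).x (S.piece j).U (closure D) := fun u hu =>
    frontier_subset_closure (hS ▸ mem_iUnion.mpr ⟨j, u, hu, rfl⟩)
  have hx := (S.piece j).contDiffOn_x.continuousOn
  have hU := (S.piece j).isCompact_U.measurableSet
  obtain ⟨C, hC⟩ := hDb.isCompact_closure.exists_bound_of_continuousOn hf
  refine (S.piece j).integrableOn_abs_normalVector_mul i
    (((measurable_exitSign hD i).comp_aemeasurable (hx.aemeasurable hU)).aestronglyMeasurable.mul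
      ((hf.comp hx hmaps).aestronglyMeasurable hU)) (C := C) fun u hu => ?_
  rw [abs_mul]
  refine (mul_le_of_le_one_left (abs_nonneg _) (abs_exitSign_le_one D i _)).trans ?_
  exact hC _ (hmaps hu)

/-- The divergence theorem for a vector field parallel to the `i`-th axis, by integration over the
lines in this direction. -/
theorem IsUnitOuterNormalField.integral_fderiv_single_eq (hD : IsOpen D)
    (hDb : Bornology.IsBounded D) (hS : S.carrier = frontier D)
    (hν : S.IsUnitOuterNormalField D ν) (i : Fin (n + 1))
    {f : EuclideanSpace ℝ (Fin (n + 1)) → ℝ} (hf : ContinuousOn f (closure D))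
    (hfd : DifferentiableOn ℝ f D)
    (hint : IntegrableOn (fun p => fderiv ℝ f p (EuclideanSpace.single i 1)) D) :
    ∫ p in D, fderiv ℝ f p (EuclideanSpace.single i 1) =
      ∑ j, ∫ u in (S.piece j).U, |(S.piece j).normalVector u i| *
        (exitSign D i ((S.piece j).x u) * f ((S.piece j).x u)) := by
  set h : EuclideanSpace ℝ (Fin (n + 1)) → ℝ := fun p => exitSign D i p * f p with hh
  have hG : ∀ j, MeasurableSet ((S.piece j).transversalSet i) := fun j =>
    ((S.piece j).isOpen_transversalSet i).measurableSet
  have hφ : ∀ j, ∀ u ∈ (S.piece j).transversalSet i,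
      HasFDerivWithinAt (fun u => dropCoord i ((S.piece j).x u))
        ((dropCoord i).comp (fderivWithin ℝ (S.piece j).x (S.piece j).U u))
        ((S.piece j).transversalSet i) u := fun j u hu =>
    ((S.piece j).hasFDerivAt_dropCoord_x i hu.1).hasFDerivWithinAt
  have hdet : ∀ j, ∀ u ∈ (S.piece j).transversalSet i,
      ((dropCoord i).comp (fderivWithin ℝ (S.piece j).x (S.piece j).U u)).det ≠ 0 :=
    fun j u hu h0 => hu.2 (((S.piece j).normalVector_apply_eq_zero_iff i u).mpr h0)
  have hsurf := fun j => integrableOn_abs_normalVector_mul_exitSign hD hDb hS hf i j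
  have harea := fun j => integrable_tsum_fibre_and_integral_eq volume (hG j) (hφ j) (hdet j)
    (g := fun u => h ((S.piece j).x u)) (by
      simp only [← ParametrizedSurface.abs_normalVector_apply]
      exact (hsurf j).mono_set fun u hu => interior_subset hu.1)
  have htrans : ∀ j, ∫ u in (S.piece j).U, |(S.piece j).normalVector u i| * h ((S.piece j).x u) =
      ∫ u in (S.piece j).transversalSet i,
        |(S.piece j).normalVector u i| * h ((S.piece j).x u) := by
    intro j
    rw [← ParametrizedSurface.restrict_interior_U]
    refine (setIntegral_eq_of_subset_of_forall_sdiff_eq_zero isOpen_interior.measurableSet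
      (fun u hu => hu.1) fun u hu => ?_)
    have : (S.piece j).normalVector u i = 0 := by
      by_contra h0
      exact hu.2 ⟨hu.1, h0⟩
    simp [this]
  obtain ⟨hslice, hfub⟩ := setIntegral_eq_integral_setIntegral_insertCoord i hD.measurableSet hint
  calc ∫ p in D, fderiv ℝ f p (EuclideanSpace.single i 1)
      = ∫ y, ∑ j, ∑' u : ↥((S.piece j).transversalSet i ∩
          (fun u => dropCoord i ((S.piece j).x u)) ⁻¹' {y}), h ((S.piece j).x u) := by
        rw [hfub]
        refine integral_congr_ae ?_
        filter_upwards [hslice, S.ae_isTransversalLine i] with y hy1 hy2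
        have hfin := hy2.finite_carrier hD hDb hS hν
        have hA : ∀ t, t ∈ hfin.toFinset ↔ insertCoord i y t ∈ S.carrier := by simp
        rw [hy2.setIntegral_eq_sum hD hDb hS hν hf hfd hy1 hA, hy2.sum_tsum_fibre_eq h hA]
    _ = ∑ j, ∫ u in (S.piece j).transversalSet i,
          |(S.piece j).normalVector u i| * h ((S.piece j).x u) := by
        rw [integral_finsetSum _ fun j _ => (harea j).1]
        refine Finset.sum_congr rfl fun j _ => ?_
        simp only [ParametrizedSurface.abs_normalVector_apply]
        exact (harea j).2
    _ = _ := Finset.sum_congr rfl fun j _ => (htrans j).symm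

/-! ### The normal field off a null set -/

/-- Points where pieces run through edges are negligible: the projection along the `i`-th axis maps
the parameters in question into the null set of the projected edges, while it is a local
diffeomorphism there. -/
theorem volume_transversalSet_inter_preimage_edges (S : PiecewiseHypersurface n) (i : Fin (n + 1))
    (j : Fin S.len) :
    volume ((S.piece j).transversalSet i ∩ (S.piece j).x ⁻¹' S.edges) = 0 := by
  have hcl : IsClosed S.edges := isClosed_iUnion_of_finite fun k =>
    (((S.piece k).isCompact_U.of_isClosed_subset isClosed_frontier
      (S.piece k).isCompact_U.isClosed.frontier_subset).image_of_continuousOn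
      ((S.piece k).contDiffOn_x.continuousOn.mono
        (S.piece k).isCompact_U.isClosed.frontier_subset)).isClosed
  have hcont : ContinuousOn (S.piece j).x ((S.piece j).transversalSet i) :=
    (S.piece j).contDiffOn_x.continuousOn.mono fun u hu => interior_subset hu.1
  have hopen := (S.piece j).isOpen_transversalSet i
  have hmeas : MeasurableSet ((S.piece j).transversalSet i ∩ (S.piece j).x ⁻¹' S.edges) := by
    rw [← sdiff_compl, ← preimage_compl, ← sdiff_inter_self_eq_sdiff, inter_comm]
    exact MeasurableSet.diff hopen.measurableSet
      (hcont.isOpen_inter_preimage hopen hcl.isOpen_compl).measurableSet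
  refine measure_eq_zero_of_image_null_of_det_ne_zero volume
    (φ := fun u => dropCoord i ((S.piece j).x u)) hmeas
    (fun u hu => ((S.piece j).hasFDerivAt_dropCoord_x i hu.1.1).hasFDerivWithinAt)
    (fun u hu h0 => hu.1.2 (((S.piece j).normalVector_apply_eq_zero_iff i u).mpr h0)) ?_
  refine measure_mono_null ?_ (measure_iUnion_null fun k =>
    (S.piece k).volume_dropCoord_image_frontier i)
  rintro _ ⟨u, hu, rfl⟩
  obtain ⟨k, v, hv, hvu⟩ := mem_iUnion.mp hu.2
  exact mem_iUnion.mpr ⟨k, v, hv, congrArg (dropCoord i) hvu⟩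

/-- The surface integrand `F · ν |N|` in terms of the crossing signs. Where the surface runs through
an edge, `ν` is unknown, but almost everywhere there `N = 0`. -/
theorem IsUnitOuterNormalField.ae_inner_mul_norm_eq (hD : IsOpen D) (hS : S.carrier = frontier D)
    (hν : S.IsUnitOuterNormalField D ν)
    (F : EuclideanSpace ℝ (Fin (n + 1)) → EuclideanSpace ℝ (Fin (n + 1))) (j : Fin S.len) :
    ∀ᵐ u ∂volume.restrict (S.piece j).U,
      inner ℝ (F ((S.piece j).x u)) (ν ((S.piece j).x u)) * ‖(S.piece j).normalVector u‖ =
        ∑ i, |(S.piece j).normalVector u i| *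
          (exitSign D i ((S.piece j).x u) * F ((S.piece j).x u) i) := by
  rw [← ParametrizedSurface.restrict_interior_U,
    ae_restrict_iff' isOpen_interior.measurableSet]
  have hnull : ∀ᵐ u, ∀ i, u ∉ (S.piece j).transversalSet i ∩ (S.piece j).x ⁻¹' S.edges :=
    ae_all_iff.mpr fun i => measure_eq_zero_iff_ae_notMem.mp
      (S.volume_transversalSet_inter_preimage_edges i j)
  filter_upwards [hnull] with u hu hui
  by_cases hedge : (S.piece j).x u ∈ S.edges
  · have h0 : ∀ i, (S.piece j).normalVector u i = 0 := fun i => by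
      by_contra h
      exact hu i ⟨⟨hui, h⟩, hedge⟩
    have hN : (S.piece j).normalVector u = 0 := by ext i; simpa using h0 i
    simp [hN]
  · obtain ⟨hν1, hν2, -⟩ := hν j u hui hedge
    rw [PiLp.inner_apply, Finset.sum_mul]
    refine Finset.sum_congr rfl fun i _ => ?_
    have hstar := (S.piece j).apply_mul_norm_normalVector hν1 hν2 i
    have hsign : exitSign D i ((S.piece j).x u) * |(S.piece j).normalVector u i| =
        SignType.sign (ν ((S.piece j).x u) i) * |(S.piece j).normalVector u i| := by
      by_cases hN : (S.piece j).normalVector u i = 0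
      · simp [hN]
      · rw [hν.exitSign_eq_sign hD hS hui hedge hN]
    change ν ((S.piece j).x u) i * F ((S.piece j).x u) i * _ = _
    linear_combination F ((S.piece j).x u) i * hstar - F ((S.piece j).x u) i * hsign

end PiecewiseHypersurface

theorem theorem2 (n : ℕ) (hn : 1 ≤ n)
    (D : Set (EuclideanSpace ℝ (Fin (n + 1)))) (hD_open : IsOpen D)
    (hD_bdd : Bornology.IsBounded D)
    (S : PiecewiseHypersurface n) (hS : S.carrier = frontier D)
    (F : EuclideanSpace ℝ (Fin (n + 1)) → EuclideanSpace ℝ (Fin (n + 1)))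
    (hF : ContDiffOn ℝ 1 F (closure D))
    (ν : EuclideanSpace ℝ (Fin (n + 1)) → EuclideanSpace ℝ (Fin (n + 1)))
    (hν : S.IsUnitOuterNormalField D ν) :
    IntegrableOn (divergence F) D ∧
      S.SurfaceIntegrable (fun y => inner ℝ (F y) (ν y)) ∧
      ∫ y in D, divergence F y = S.surfaceIntegral (fun y => inner ℝ (F y) (ν y)) := by
  have hFD : ContDiffOn ℝ 1 F D := hF.mono subset_closure
  have hFd : ∀ p ∈ D, DifferentiableAt ℝ F p := fun p hp =>
    (hFD.differentiableOn one_ne_zero).differentiableAt (hD_open.mem_nhds hp)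
  obtain ⟨C, hC⟩ := hF.exists_bound_fderiv_interior hD_bdd.isCompact_closure
  have hcomp : ∀ i, ∀ p ∈ D, fderiv ℝ (fun p => F p i) p (EuclideanSpace.single i 1) =
      fderiv ℝ F p (EuclideanSpace.single i 1) i := by
    intro i p hp
    have h : HasFDerivAt (fun p => F p i)
        ((EuclideanSpace.proj i : EuclideanSpace ℝ (Fin (n + 1)) →L[ℝ] ℝ).comp (fderiv ℝ F p)) p :=
      (EuclideanSpace.proj i : EuclideanSpace ℝ (Fin (n + 1)) →L[ℝ] ℝ).hasFDerivAt.comp p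
        (hFd p hp).hasFDerivAt
    rw [h.fderiv]
    rfl
  have hint : ∀ i, IntegrableOn (fun p => fderiv ℝ F p (EuclideanSpace.single i 1) i) D := by
    intro i
    refine IntegrableOn.of_bound ((measure_mono subset_closure).trans_lt
      hD_bdd.isCompact_closure.measure_lt_top) ?_ C ?_
    · refine ContinuousOn.aestronglyMeasurable ?_ hD_open.measurableSet
      exact (EuclideanSpace.proj (𝕜 := ℝ) i).continuous.comp_continuousOn
        ((hFD.continuousOn_fderiv_of_isOpen hD_open le_rfl).clm_apply continuousOn_const)
    · filter_upwards [ae_restrict_mem hD_open.measurableSet] with p hp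
      refine (PiLp.norm_apply_le _ i).trans ((ContinuousLinearMap.le_opNorm _ _).trans ?_)
      rw [PiLp.norm_single, norm_one, mul_one]
      exact hC p (interior_mono subset_closure (hD_open.interior_eq.symm ▸ hp))
  have hint' : ∀ i, IntegrableOn
      (fun p => fderiv ℝ (fun p => F p i) p (EuclideanSpace.single i 1)) D := fun i =>
    (hint i).congr_fun (fun p hp => (hcomp i p hp).symm) hD_open.measurableSet
  have hcont : ∀ i, ContinuousOn (fun p => F p i) (closure D) := fun i =>
    (EuclideanSpace.proj (𝕜 := ℝ) i).continuous.comp_continuousOn hF.continuousOn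
  have hsurf := fun i j => PiecewiseHypersurface.integrableOn_abs_normalVector_mul_exitSign hD_open
    hD_bdd hS (hcont i) i j
  have hae := fun j => hν.ae_inner_mul_norm_eq hD_open hS F j
  refine ⟨integrable_finsetSum _ fun i _ => hint i, fun j => ?_, ?_⟩
  · exact (integrable_finsetSum _ fun i _ => hsurf i j).congr
      ((hae j).mono fun u hu => by simpa using hu.symm)
  · have hpart : ∀ i, ∫ p in D, fderiv ℝ F p (EuclideanSpace.single i 1) i =
        ∑ j, ∫ u in (S.piece j).U, |(S.piece j).normalVector u i| *
          (exitSign D i ((S.piece j).x u) * F ((S.piece j).x u) i) := by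
      intro i
      rw [← hν.integral_fderiv_single_eq hD_open hD_bdd hS i (hcont i)
        (fun p hp => ((EuclideanSpace.proj (𝕜 := ℝ) i).differentiableAt.comp p
          (hFd p hp)).differentiableWithinAt) (hint' i)]
      exact setIntegral_congr_fun hD_open.measurableSet fun p hp => (hcomp i p hp).symm
    simp only [divergence]
    rw [integral_finsetSum _ fun i _ => hint i, Finset.sum_congr rfl fun i _ => hpart i,
      Finset.sum_comm]
    refine Finset.sum_congr rfl fun j _ => ?_
    rw [ParametrizedSurface.surfaceIntegral, integral_congr_ae (hae j),
      integral_finsetSum _ fun i _ => hsurf i j]
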